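/- Let $\lambda^d$ denote Lebesgue measure on $\mathbb{R}^d$. For a family $\mathcal{A}$ of Lebesgue measurable subsets of $\mathbb{R}^d$ of finite measure we say that an element of $\mathcal{A}$ can be reconstructed using $n$ test sets if there exist Lebesgue measurable sets $T_1,\dots,T_n\subset\mathbb{R}^d$ such that whenever $A,B\in\mathcal{A}$ and $\lambda^d(A\cap T_i)=\lambda^d(B\cap T_i)$ for every $i=1,\dots,n$, then $A=B$. A (not necessarily convex) polytope in $\mathbb{R}^d$ is a set with nonempty interior that is a union of finitely many convex hulls of finite sets. Let $d\ge 2$. (1) A ball of radius at least $1$ in $\mathbb{R}^d$ can be reconstructed using $d+1$ test sets; that is, there are Lebesgue measurable sets $T_1,\dots,T_{d+1}\subset\mathbb{R}^d$ such that if $x,x'\in\mathbb{R}^d$, $r,r'\ge 1$ and $(x,r)\ne(x',r')$, then $\lambda^d(B(x,r)\cap T_i)\ne\lambda^d(B(x',r')\cap T_i)$ for some $i\in\{1,\dots,d+1\}$, where $B(x,r)$ is the closed ball with centre $x$ and radius $r$. (2) Let $E$ be a (not necessarily convex) polytope in $\mathbb{R}^d$. Then a magnified copy of $E$, that is, an element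 of the family $\{rE+x : r\ge 1,\ x\in\mathbb{R}^d\}$, can be reconstructed using $d+1$ test sets. -/

import Mathlib

open MeasureTheory

/-- An element of the family `𝒜` of Lebesgue measurable subsets of `ℝ^d` of finite measure can be
reconstructed using `n` test sets: there are Lebesgue measurable sets `T₁, …, Tₙ` such that
members of `𝒜` whose intersections with each `Tᵢ` have the same measure are equal.
`NullMeasurableSet` with respect to `volume` is Lebesgue measurability. -/
def CanBeReconstructed {d : ℕ} (𝒜 : Set (Set (EuclideanSpace ℝ (Fin d)))) (n : ℕ) : Prop :=
  (∀ A ∈ 𝒜, NullMeasurableSet A volume ∧ volume A < ⊤) ∧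
  ∃ T : Fin n → Set (EuclideanSpace ℝ (Fin d)),
    (∀ i, NullMeasurableSet (T i) volume) ∧
    ∀ A ∈ 𝒜, ∀ B ∈ 𝒜, (∀ i, volume (A ∩ T i) = volume (B ∩ T i)) → A = B

/-- The family of all (closed) balls of radius at least `1` in `ℝ^d`. -/
def largeBalls (d : ℕ) : Set (Set (EuclideanSpace ℝ (Fin d))) :=
  {A | ∃ (x : EuclideanSpace ℝ (Fin d)) (r : ℝ), 1 ≤ r ∧ A = Metric.closedBall x r}

/-- The family of all magnified copies `r E + x`, `r ≥ 1`, `x ∈ ℝ^d`, of a set `E ⊆ ℝ^d`. -/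
def magnifiedCopies {d : ℕ} (E : Set (EuclideanSpace ℝ (Fin d))) :
    Set (Set (EuclideanSpace ℝ (Fin d))) :=
  {A | ∃ (x : EuclideanSpace ℝ (Fin d)) (r : ℝ), 1 ≤ r ∧ A = (fun y => r • y + x) '' E}

/-- A (not necessarily convex, solid) polytope in `ℝ^d`: a union of finitely many convex polytopes
(convex hulls of finite sets) that has nonempty interior. -/
def IsPolytope {d : ℕ} (E : Set (EuclideanSpace ℝ (Fin d))) : Prop :=
  (interior E).Nonempty ∧
  ∃ F : Set (Set (EuclideanSpace ℝ (Fin d))), F.Finite ∧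
    (∀ P ∈ F, ∃ s : Set (EuclideanSpace ℝ (Fin d)), s.Finite ∧ P = convexHull ℝ s) ∧
    E = ⋃₀ F

/-! The whole space as a test set gives the volume, hence `r`. Of the remaining `d` test sets, one
recovers one coordinate `s` of `x`, and each of the others recovers one further coordinate.

The set for `s` is a union of slabs `{s ∈ S}`. Here `S ⊆ ℝ` follows the increasing density
`slowSigmoid` on cells that shrink like `|s| ^ (-3)`. Shifting a copy by `τ` gains about `τ` times
its volume times the slope of the density, of order `(1 + |s|) ^ (-3/2)`. The oscillation `h = 1_S -
slowSigmoid` must cost less, with an error also linear in `τ`. Slicing turns the error into `∫ (φ(s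
- τ) - φ(s)) h(s) ds`, where `φ` is the length of a slice of a convex body. Roundness (a chord of
length `ℓ` has room `c ℓ²` on both sides of its midpoint) confines large increments of `φ` to short
intervals: those above `a` fill an interval of length at most `τ² / (c a²)`. As `h` integrates to at
most `κ` over intervals, a layer-cake integral bounds the error by a multiple of `τ √(κ / c)`. With
`κ` of order `|s| ^ (-3)` this has the order of the gain, and a small constant makes it smaller
(`exists_slab_set_strict_increase`).

Once `s` is known, a coordinate `ℓ` is read off from the region above the graph of `tan (π s / ρ)`,
where `E` contains a ball of radius `ρ`. A translation that raises `ℓ` and fixes `s` only adds to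
the intersection, and adds positive measure because the graph takes every height within one period
(`volume_inter_aboveTan_lt`).

Balls are round. Simplices are round along a generic direction, and inclusion–exclusion passes to
their unions because roundness and convexity survive intersection. -/

/-! ### Integrals of oscillating functions against increments of concave functions -/

theorem abs_setIntegral_le_of_ordConnected {h : ℝ → ℝ} {J : Set ℝ} {lo hi κ : ℝ}
    (hJ : J.OrdConnected) (hsub : J ⊆ Set.Icc lo hi) (hκ : 0 ≤ κ)
    (hh : ∀ u v, lo ≤ u → u ≤ v → v ≤ hi → |∫ s in u..v, h s| ≤ κ) :
    |∫ s in J, h s| ≤ κ := by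
  rcases J.eq_empty_or_nonempty with rfl | hne
  · simpa using hκ
  have hbb : BddBelow J := ⟨lo, fun x hx => (hsub hx).1⟩
  have hba : BddAbove J := ⟨hi, fun x hx => (hsub hx).2⟩
  have hle : sInf J ≤ sSup J := csInf_le_csSup hne hbb hba
  have h1 : Set.Ioo (sInf J) (sSup J) ⊆ J := by
    intro x hx
    obtain ⟨a, ha, hax⟩ := exists_lt_of_csInf_lt hne hx.1
    obtain ⟨b, hb, hxb⟩ := exists_lt_of_lt_csSup hne hx.2
    exact hJ.out ha hb ⟨hax.le, hxb.le⟩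
  have h2 : J ⊆ Set.Icc (sInf J) (sSup J) := fun x hx => ⟨csInf_le hbb hx, le_csSup hba hx⟩
  have hae : J =ᵐ[volume] Set.Ioc (sInf J) (sSup J) := by
    refine Filter.EventuallyLE.antisymm ?_ ?_
    · exact (LE.le.eventuallyLE h2 : J ≤ᵐ[volume] _).trans Ioc_ae_eq_Icc.symm.le
    · exact Ioo_ae_eq_Ioc.symm.le.trans (LE.le.eventuallyLE h1)
  rw [setIntegral_congr_set hae, ← intervalIntegral.integral_of_le hle]
  refine hh _ _ ?_ hle ?_
  · exact le_csInf hne fun x hx => (hsub hx).1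
  · exact csSup_le hne fun x hx => (hsub hx).2

/-- A layer-cake bound: if the superlevel sets of `D` are intervals that are short at high levels,
and the integrals of `h` over all intervals are small, then so is the integral of `D * h`. -/
theorem abs_integral_mul_le_of_superlevel {D h : ℝ → ℝ} {lo hi κ B Q : ℝ}
    (hD : Measurable D) (hD0 : ∀ s, 0 ≤ D s) (hDQ : ∀ s, D s ≤ Q)
    (hh : Measurable h) (hh1 : ∀ s, |h s| ≤ 1)
    (hsupp : ∀ s, 0 < D s → s ∈ Set.Icc lo hi)
    (hconn : ∀ a, 0 < a → {s | a < D s}.OrdConnected)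
    (hvol : ∀ a, 0 < a → volume.real {s | a < D s} ≤ B ^ 2 / a ^ 2)
    (hκ : 0 < κ) (hB : 0 < B)
    (hint : ∀ u v, lo ≤ u → u ≤ v → v ≤ hi → |∫ s in u..v, h s| ≤ κ) :
    |∫ s, D s * h s| ≤ 2 * Real.pi * (B * √κ) := by
  have hQ : 0 ≤ Q := (hD0 0).trans (hDQ 0)
  set F : ℝ → ℝ → ℝ := fun s a => {p : ℝ × ℝ | p.2 < D p.1}.indicator (fun p => h p.1) (s, a) with hF
  have hms : MeasurableSet {p : ℝ × ℝ | p.2 < D p.1} :=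
    measurableSet_lt measurable_snd (hD.comp measurable_fst)
  have hFm : Measurable (Function.uncurry F) := by
    have : Function.uncurry F = {p : ℝ × ℝ | p.2 < D p.1}.indicator (fun p => h p.1) := rfl
    rw [this]
    exact (hh.comp measurable_fst).indicator hms
  have hFb : ∀ s a, |F s a| ≤ 1 := by
    intro s a
    simp only [hF, Set.indicator_apply]
    split_ifs
    · exact hh1 s
    · simp
  have hFi : Integrable (Function.uncurry F)
      ((volume.restrict (Set.Icc lo hi)).prod (volume.restrict (Set.Ioc 0 Q))) :=
    Integrable.of_bound hFm.aestronglyMeasurable 1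
      (Filter.Eventually.of_forall fun p => hFb p.1 p.2)
  have hswap := integral_integral_swap hFi
  have hL : ∀ s, ∫ a in Set.Ioc 0 Q, F s a = D s * h s := by
    intro s
    have h1 : ∀ a, F s a = (Set.Iio (D s)).indicator (fun _ => h s) a := fun a => rfl
    simp_rw [h1]
    rw [integral_indicator measurableSet_Iio, setIntegral_const, smul_eq_mul,
      measureReal_restrict_apply measurableSet_Iio]
    congr 1
    have : Set.Iio (D s) ∩ Set.Ioc 0 Q = Set.Ioo 0 (D s) := by
      ext a
      simp only [Set.mem_inter_iff, Set.mem_Iio, Set.mem_Ioc, Set.mem_Ioo]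
      exact ⟨fun ⟨h1, h2, _⟩ => ⟨h2, h1⟩, fun ⟨h1, h2⟩ => ⟨h2, h1, h2.le.trans (hDQ s)⟩⟩
    rw [this, Real.volume_real_Ioo_of_le (hD0 s), sub_zero]
  have hLL : ∫ s, D s * h s = ∫ s in Set.Icc lo hi, ∫ a in Set.Ioc 0 Q, F s a := by
    simp_rw [hL]
    refine (setIntegral_eq_integral_of_forall_compl_eq_zero fun s hs => ?_).symm
    rcases (hD0 s).eq_or_lt with h0 | h0
    · rw [← h0, zero_mul]
    · exact absurd (hsupp s h0) hs
  -- The bounds `κ` and `B² / a²` cross at `a = B / √κ = 1 / c`. Their minimum is at most `2κ / (1 +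
  -- (c a)²)`, whose integral over the line is explicit.
  set c : ℝ := √κ / B with hc
  have hc0 : 0 < c := div_pos (Real.sqrt_pos.2 hκ) hB
  have hR : ∀ a ∈ Set.Ioc 0 Q, ‖∫ s in Set.Icc lo hi, F s a‖ ≤ 2 * κ * (1 + (c * a) ^ 2)⁻¹ := by
    intro a ha
    have hsub : {s | a < D s} ⊆ Set.Icc lo hi := fun s hs => hsupp s (ha.1.trans hs)
    have hmeas : MeasurableSet {s | a < D s} := measurableSet_lt measurable_const hD
    have h1 : ∫ s in Set.Icc lo hi, F s a = ∫ s in {s | a < D s}, h s := by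
      have h2 : ∀ s, F s a = {s | a < D s}.indicator h s := fun s => rfl
      simp_rw [h2]
      rw [setIntegral_indicator hmeas, Set.inter_eq_right.2 hsub]
    have hb1 : |∫ s in {s | a < D s}, h s| ≤ κ :=
      abs_setIntegral_le_of_ordConnected (hconn a ha.1) hsub hκ.le hint
    have hb2 : |∫ s in {s | a < D s}, h s| ≤ B ^ 2 / a ^ 2 := by
      have hlt : volume {s | a < D s} < ⊤ :=
        (measure_mono hsub).trans_lt (by rw [Real.volume_Icc]; exact ENNReal.ofReal_lt_top)
      have := norm_setIntegral_le_of_norm_le_const hlt (C := 1) (f := h)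
        (fun s _ => by simpa using hh1 s)
      rw [one_mul, Real.norm_eq_abs] at this
      exact this.trans (hvol a ha.1)
    rw [h1, Real.norm_eq_abs]
    set X := |∫ s in {s | a < D s}, h s|
    have ha2 : 0 < a ^ 2 := by have := ha.1; positivity
    have hca : (c * a) ^ 2 = κ * a ^ 2 / B ^ 2 := by
      rw [hc, mul_pow, div_pow, Real.sq_sqrt hκ.le]; ring
    have hb3 : X * (c * a) ^ 2 ≤ κ := by
      rw [hca]
      rw [le_div_iff₀ ha2] at hb2
      have : X * (κ * a ^ 2 / B ^ 2) = κ * (X * a ^ 2) / B ^ 2 := by ring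
      rw [this, div_le_iff₀ (by positivity)]
      exact mul_le_mul_of_nonneg_left hb2 hκ.le
    rw [← div_eq_mul_inv, le_div_iff₀ (by positivity)]
    nlinarith
  have hint2 : Integrable (fun a : ℝ => 2 * κ * (1 + (c * a) ^ 2)⁻¹) :=
    (integrable_inv_one_add_sq.comp_mul_left' hc0.ne').const_mul _
  have hval : ∫ a : ℝ, 2 * κ * (1 + (c * a) ^ 2)⁻¹ = 2 * Real.pi * (B * √κ) := by
    rw [integral_const_mul, Measure.integral_comp_mul_left (fun x : ℝ => (1 + x ^ 2)⁻¹) c,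
      integral_univ_inv_one_add_sq, abs_of_pos (inv_pos.2 hc0), hc, smul_eq_mul, inv_div]
    have := Real.mul_self_sqrt hκ.le
    have h0 := (Real.sqrt_pos.2 hκ).ne'
    field_simp
    nlinarith
  rw [hLL, hswap, ← Real.norm_eq_abs, ← hval]
  refine (norm_integral_le_of_norm_le hint2.integrableOn
    ((ae_restrict_iff' measurableSet_Ioc).2 (Filter.Eventually.of_forall hR))).trans ?_
  exact setIntegral_le_integral hint2 (Filter.Eventually.of_forall fun a => by positivity)

/-- Slopes of a concave function decrease, so a rise of more than `a` over the last `τ` forces a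
mean slope above `a / τ` all the way from `x`, while `φ x ≥ 0`. -/
theorem ConcaveOn.mul_sub_le_of_lt_increment {φ : ℝ → ℝ} {I : Set ℝ} {τ a x s : ℝ}
    (hφ : ConcaveOn ℝ I φ) (hφ0 : ∀ s, 0 ≤ φ s) (hx : x ∈ I) (hs : s ∈ I)
    (hτ : 0 < τ) (ha : 0 < a) (hsa : a < φ s - φ (s - τ)) :
    a * (s - x) ≤ τ * φ s := by
  have h0 := hφ0 (s - τ)
  have h1 := hφ0 x
  rcases le_or_gt (s - x) τ with h | h
  · nlinarith
  · have hlt1 : x < s - τ := by linarith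
    have hlt2 : s - τ < s := by linarith
    have := hφ.slope_anti_adjacent hx hs hlt1 hlt2
    rw [div_le_div_iff₀ (by linarith) (by linarith)] at this
    have h2 : a * (s - τ - x) ≤ (φ s - φ (s - τ)) * (s - τ - x) :=
      mul_le_mul_of_nonneg_right hsa.le (by linarith)
    nlinarith

theorem ConcaveOn.ordConnected_lt_increment {φ : ℝ → ℝ} {I : Set ℝ} {τ a : ℝ}
    (hφ : ConcaveOn ℝ I φ) (hφ0 : ∀ s, 0 ≤ φ s) (hI : ∀ s, s ∉ I → φ s = 0)
    (hτ : 0 < τ) (ha : 0 < a) : {s | a < φ s - φ (s - τ)}.OrdConnected := by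
  have hmem : ∀ s, a < φ s - φ (s - τ) → s ∈ I := by
    intro s hs
    by_contra h
    have := hφ0 (s - τ)
    rw [hI s h] at hs
    linarith
  refine ⟨fun s₁ h₁ s₂ h₂ s hs => ?_⟩
  have hI₁ := hmem _ h₁
  have hI₂ := hmem _ h₂
  have hI₀ : s ∈ I := hφ.1.ordConnected.out hI₁ hI₂ hs
  simp only [Set.mem_ofPred_eq] at h₁ h₂ ⊢
  by_cases hm : s - τ ∈ I
  -- Both `s` and `s₂ - τ` lie between `s - τ` and `s₂`, with exchanged weights. Adding the two
  -- concavity inequalities gives `φ (s - τ) + φ s₂ ≤ φ s + φ (s₂ - τ)`.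
  · refine h₂.trans_le ?_
    have hpos : 0 < τ + (s₂ - s) := by linarith [hs.2]
    have hcc := hφ.2
    have h2 := hcc hm hI₂ (a := τ / (τ + (s₂ - s))) (b := (s₂ - s) / (τ + (s₂ - s)))
      (by positivity) (div_nonneg (by linarith [hs.2]) hpos.le) (by field_simp)
    have h1 := hcc hm hI₂ (a := (s₂ - s) / (τ + (s₂ - s))) (b := τ / (τ + (s₂ - s)))
      (div_nonneg (by linarith [hs.2]) hpos.le) (by positivity) (by field_simp; ring)
    have e1 : ((s₂ - s) / (τ + (s₂ - s))) • (s - τ) + (τ / (τ + (s₂ - s))) • s₂ = s := by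
      simp only [smul_eq_mul]; field_simp; ring
    have e2 : (τ / (τ + (s₂ - s))) • (s - τ) + ((s₂ - s) / (τ + (s₂ - s))) • s₂ = s₂ - τ := by
      simp only [smul_eq_mul]; field_simp; ring
    rw [e1] at h1
    rw [e2] at h2
    have e3 : τ / (τ + (s₂ - s)) + (s₂ - s) / (τ + (s₂ - s)) = 1 := by field_simp
    simp only [smul_eq_mul] at h1 h2
    have e4 : τ / (τ + (s₂ - s)) = 1 - (s₂ - s) / (τ + (s₂ - s)) := by linarith
    rw [e4] at h1 h2
    linarith
  -- Here the increment is `φ s` itself, and a concave function is at least the minimum of its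
  -- values at the two ends.
  · rw [hI _ hm, sub_zero]
    have h3 := hφ.min_le_of_mem_Icc hI₁ hI₂ hs
    refine lt_of_lt_of_le (lt_min ?_ ?_) h3
    · linarith [hφ0 (s₁ - τ)]
    · linarith [hφ0 (s₂ - τ)]

/-- The slope bound is used twice. From `s₂ - c φ(s₂)²` it yields `φ(s₂) ≤ τ / (a c)`; from `s₁` it
yields `s₂ - s₁ ≤ τ φ(s₂) / a`. -/
theorem ConcaveOn.sub_le_of_lt_increment {φ : ℝ → ℝ} {I : Set ℝ} {c τ a s₁ s₂ : ℝ}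
    (hφ : ConcaveOn ℝ I φ) (hφ0 : ∀ s, 0 ≤ φ s) (hI : ∀ s, s ∉ I → φ s = 0)
    (hround : ∀ s ∈ I, s - c * φ s ^ 2 ∈ I) (hc : 0 < c)
    (hτ : 0 < τ) (ha : 0 < a) (h₁ : a < φ s₁ - φ (s₁ - τ)) (h₂ : a < φ s₂ - φ (s₂ - τ)) :
    s₂ - s₁ ≤ τ ^ 2 / c / a ^ 2 := by
  have hmem : ∀ s, a < φ s - φ (s - τ) → s ∈ I := by
    intro s hs
    by_contra h
    have := hφ0 (s - τ)
    rw [hI s h] at hs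
    linarith
  have h3 := hφ.mul_sub_le_of_lt_increment hφ0 (hmem _ h₁) (hmem _ h₂) hτ ha h₂
  have h4 := hφ.mul_sub_le_of_lt_increment hφ0 (hround _ (hmem _ h₂)) (hmem _ h₂) hτ ha h₂
  have hpos : 0 < φ s₂ := by linarith [hφ0 (s₂ - τ)]
  have h5 : a * c * φ s₂ ≤ τ := by
    have : (a * c * φ s₂) * φ s₂ ≤ τ * φ s₂ := by linarith [h4]
    exact le_of_mul_le_mul_right this hpos
  rw [div_div, le_div_iff₀ (by positivity)]
  nlinarith [mul_le_mul_of_nonneg_left h3 (mul_pos ha hc).le, mul_le_mul_of_nonneg_left h5 hτ.le]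

theorem Real.volume_real_le_of_forall_sub_le {A : Set ℝ} {L : ℝ} (hL : 0 ≤ L)
    (h : ∀ x ∈ A, ∀ y ∈ A, y - x ≤ L) : volume.real A ≤ L := by
  refine ENNReal.toReal_le_of_le_ofReal hL ((Real.volume_le_diam A).trans ?_)
  refine Metric.ediam_le fun x hx y hy => ?_
  rw [edist_dist, Real.dist_eq]
  exact ENNReal.ofReal_le_ofReal (abs_sub_le_iff.2 ⟨h y hy x hx, h x hx y hy⟩)

/-- Oscillation estimate for a concave profile `φ` whose value controls the distance to the ends of
its support: integrals of `h` against increments of `φ` are small if `h` oscillates quickly. -/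
theorem ConcaveOn.abs_integral_increment_mul_le {φ h : ℝ → ℝ} {I : Set ℝ}
    {c τ lo hi κ Q : ℝ} (hφ : ConcaveOn ℝ I φ) (hφm : Measurable φ) (hφ0 : ∀ s, 0 ≤ φ s)
    (hφQ : ∀ s, φ s ≤ Q) (hI : ∀ s, s ∉ I → φ s = 0)
    (hround : ∀ s ∈ I, s - c * φ s ^ 2 ∈ I ∧ s + c * φ s ^ 2 ∈ I) (hc : 0 < c)
    (hτ : 0 < τ) (hIlo : ∀ s ∈ I, lo ≤ s) (hIhi : ∀ s ∈ I, s + τ ≤ hi)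
    (hh : Measurable h) (hh1 : ∀ s, |h s| ≤ 1) (hκ : 0 < κ)
    (hint : ∀ u v, lo ≤ u → u ≤ v → v ≤ hi → |∫ s in u..v, h s| ≤ κ) :
    |∫ s, (φ (s - τ) - φ s) * h s| ≤ 4 * Real.pi * (τ / √c * √κ) := by
  have hB : 0 < τ / √c := div_pos hτ (Real.sqrt_pos.2 hc)
  have hB2 : (τ / √c) ^ 2 = τ ^ 2 / c := by rw [div_pow, Real.sq_sqrt hc.le]
  have hφm' : Measurable fun s => φ (s - τ) := hφm.comp (measurable_id.sub_const τ)
  have hmem : ∀ s, 0 < φ s → s ∈ I := fun s hs => by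
    by_contra h'; exact hs.ne' (hI s h')
  -- the increasing part
  have hmax : ∀ x a : ℝ, 0 < a → (a < max x 0 ↔ a < x) := fun x a ha => by
    rw [lt_max_iff]; exact ⟨fun h => h.resolve_right (by linarith), Or.inl⟩
  have hD1 : |∫ s, max (φ s - φ (s - τ)) 0 * h s| ≤ 2 * Real.pi * (τ / √c * √κ) := by
    refine abs_integral_mul_le_of_superlevel (Q := Q) ((hφm.sub hφm').max measurable_const)
      (fun s => le_max_right _ _) (fun s => ?_) hh hh1 (fun s hs => ?_) (fun a ha => ?_)
      (fun a ha => ?_) hκ hB hint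
    · have := hφ0 (s - τ); have := hφQ s
      exact max_le (by linarith) ((hφ0 s).trans this)
    · have h1 : 0 < φ s - φ (s - τ) := by
        rw [lt_max_iff] at hs; exact hs.resolve_right (lt_irrefl 0)
      have hs : s ∈ I := hmem s (by linarith [hφ0 (s - τ)])
      exact ⟨hIlo s hs, by linarith [hIhi s hs]⟩
    · simp only [hmax _ a ha]
      exact hφ.ordConnected_lt_increment hφ0 hI hτ ha
    · simp only [hmax _ a ha]
      rw [hB2]
      refine Real.volume_real_le_of_forall_sub_le (by positivity) fun x hx y hy => ?_
      exact hφ.sub_le_of_lt_increment hφ0 hI (fun s hs => (hround s hs).1) hc hτ ha hx hy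
  -- the decreasing part, by reflection
  set ψ : ℝ → ℝ := fun s => φ (-s) with hψ
  have hψc : ConcaveOn ℝ ((fun s : ℝ => -s) ⁻¹' I) ψ := by
    have := hφ.comp_linearMap (-LinearMap.id : ℝ →ₗ[ℝ] ℝ)
    exact this
  have hψ0 : ∀ s, 0 ≤ ψ s := fun s => hφ0 _
  have hψI : ∀ s, s ∉ (fun s : ℝ => -s) ⁻¹' I → ψ s = 0 := fun s hs => hI _ hs
  have hψr : ∀ s ∈ (fun s : ℝ => -s) ⁻¹' I, s - c * ψ s ^ 2 ∈ (fun s : ℝ => -s) ⁻¹' I := by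
    intro s hs
    have := (hround (-s) hs).2
    simp only [Set.mem_preimage, hψ]
    convert this using 1
    ring
  have hψD : ∀ s, ψ (τ - s) - ψ (τ - s - τ) = φ (s - τ) - φ s := by
    intro s; simp only [hψ]; congr 2 <;> ring
  have hD2 : |∫ s, max (φ (s - τ) - φ s) 0 * h s| ≤ 2 * Real.pi * (τ / √c * √κ) := by
    refine abs_integral_mul_le_of_superlevel (Q := Q) ((hφm'.sub hφm).max measurable_const)
      (fun s => le_max_right _ _) (fun s => ?_) hh hh1 (fun s hs => ?_) (fun a ha => ?_)
      (fun a ha => ?_) hκ hB hint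
    · have := hφ0 s; have := hφQ (s - τ)
      exact max_le (by linarith) ((hφ0 _).trans this)
    · have h1 : 0 < φ (s - τ) - φ s := by
        rw [lt_max_iff] at hs; exact hs.resolve_right (lt_irrefl 0)
      have hs : s - τ ∈ I := hmem _ (by linarith [hφ0 s])
      exact ⟨by linarith [hIlo _ hs], by linarith [hIhi _ hs]⟩
    · simp only [hmax _ a ha]
      have hoc := hψc.ordConnected_lt_increment hψ0 hψI hτ ha
      refine ⟨fun x hx y hy s hs => ?_⟩
      have h1 : τ - y ∈ {s | a < ψ s - ψ (s - τ)} := by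
        rw [Set.mem_ofPred_eq, hψD]; exact hy
      have h2 : τ - x ∈ {s | a < ψ s - ψ (s - τ)} := by
        rw [Set.mem_ofPred_eq, hψD]; exact hx
      have h3 := hoc.out h1 h2 (⟨by linarith [hs.2], by linarith [hs.1]⟩ : τ - s ∈ Set.Icc _ _)
      rw [Set.mem_ofPred_eq, hψD] at h3
      exact h3
    · simp only [hmax _ a ha]
      rw [hB2]
      refine Real.volume_real_le_of_forall_sub_le (by positivity) fun x hx y hy => ?_
      have := hψc.sub_le_of_lt_increment hψ0 hψI hψr hc hτ ha (s₁ := τ - y) (s₂ := τ - x)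
        (by rw [hψD]; exact hy) (by rw [hψD]; exact hx)
      linarith
  have hvanish : ∀ s, s ∉ Set.Icc lo hi → φ s = 0 ∧ φ (s - τ) = 0 := by
    intro s hs
    refine ⟨hI s fun h => hs ⟨hIlo s h, by linarith [hIhi s h]⟩,
      hI _ fun h => hs ⟨by linarith [hIlo _ h], by linarith [hIhi _ h]⟩⟩
  have hintg : ∀ f : ℝ → ℝ, Measurable f → (∀ s, |f s| ≤ Q) → (∀ s, s ∉ Set.Icc lo hi → f s = 0) →
      Integrable fun s => f s * h s := by
    intro f hf hfQ hf0
    have : IntegrableOn (fun s => f s * h s) (Set.Icc lo hi) := by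
      refine Measure.integrableOn_of_bounded (M := Q) (by simp) (hf.mul hh).aestronglyMeasurable
        (Filter.Eventually.of_forall fun s => ?_)
      rw [norm_mul]
      have h1 := hfQ s
      have h2 := hh1 s
      calc ‖f s‖ * ‖h s‖ ≤ Q * 1 :=
            mul_le_mul h1 h2 (norm_nonneg _) ((abs_nonneg _).trans h1)
        _ = Q := mul_one Q
    refine (integrableOn_iff_integrable_of_support_subset fun s hs => ?_).1 this
    by_contra h'
    exact hs (by simp [hf0 s h'])
  have hsplit : ∀ s, (φ (s - τ) - φ s) * h s =
      max (φ (s - τ) - φ s) 0 * h s - max (φ s - φ (s - τ)) 0 * h s := by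
    intro s
    rw [← sub_mul]
    congr 1
    rcases le_total (φ (s - τ)) (φ s) with h' | h'
    · rw [max_eq_right (by linarith), max_eq_left (by linarith)]; ring
    · rw [max_eq_left (by linarith), max_eq_right (by linarith)]; ring
  simp_rw [hsplit]
  rw [integral_sub]
  · refine (abs_sub _ _).trans ?_
    linarith
  · refine hintg (fun s => max (φ (s - τ) - φ s) 0) ((hφm'.sub hφm).max measurable_const)
      (fun s => ?_) (fun s hs => by simp [hvanish s hs])
    rw [abs_of_nonneg (le_max_right _ _)]
    exact max_le (by linarith [hφ0 s, hφQ (s - τ)]) ((hφ0 s).trans (hφQ s))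
  · refine hintg (fun s => max (φ s - φ (s - τ)) 0) ((hφm.sub hφm').max measurable_const)
      (fun s => ?_) (fun s hs => by simp [hvanish s hs])
    rw [abs_of_nonneg (le_max_right _ _)]
    exact max_le (by linarith [hφ0 (s - τ), hφQ s]) ((hφ0 s).trans (hφQ s))

/-! ### Round convex bodies and their slices -/

/-- `K` is round in the plane of `u` and `e`: every chord of `K` in direction `u` of length `ℓ` has
its midpoint at distance at least `c * ℓ ^ 2` from the complement of `K` in the directions `±e`. -/
def RoundAlong {V : Type*} [AddCommGroup V] [Module ℝ V] (u e : V) (c : ℝ) (K : Set V) : Prop :=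
  ∀ a ∈ K, ∀ ℓ : ℝ, 0 ≤ ℓ → a + ℓ • u ∈ K →
    a + (ℓ / 2) • u + (c * ℓ ^ 2) • e ∈ K ∧ a + (ℓ / 2) • u - (c * ℓ ^ 2) • e ∈ K

section Slices

variable {k : ℕ} {K : Set ((Fin k → ℝ) × ℝ × ℝ)}

theorem exists_slice_eq_Icc (hK : Convex ℝ K) (hKc : IsCompact K) {z : Fin k → ℝ} {s : ℝ}
    (hs : ∃ y, (z, s, y) ∈ K) : ∃ a b, a ≤ b ∧ {y | (z, s, y) ∈ K} = Set.Icc a b := by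
  have hc : IsCompact {y : ℝ | (z, s, y) ∈ K} := by
    refine Topology.IsClosedEmbedding.isCompact_preimage (f := fun y : ℝ => (z, s, y)) ?_ hKc
    refine Topology.IsClosedEmbedding.of_continuous_injective_isClosedMap (by fun_prop) ?_ ?_
    · intro a b h; simpa using h
    · intro C hC
      have : (fun y : ℝ => (z, s, y)) '' C = {p | p.1 = z ∧ p.2.1 = s ∧ p.2.2 ∈ C} := by
        ext ⟨p, q, r⟩
        simp only [Set.mem_image, Prod.mk.injEq, Set.mem_ofPred_eq]
        constructor
        · rintro ⟨y, hy, rfl, rfl, rfl⟩; exact ⟨rfl, rfl, hy⟩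
        · rintro ⟨rfl, rfl, hy⟩; exact ⟨r, hy, rfl, rfl, rfl⟩
      rw [this]
      exact (isClosed_eq continuous_fst continuous_const).inter
        ((isClosed_eq (by fun_prop) continuous_const).inter (hC.preimage (by fun_prop)))
  have hconv : Convex ℝ {y : ℝ | (z, s, y) ∈ K} := by
    intro y₁ h₁ y₂ h₂ a b ha hb hab
    have := hK h₁ h₂ ha hb hab
    simp only [Prod.smul_mk, Prod.mk_add_mk, ← add_smul, hab, one_smul] at this
    simpa only [Set.mem_ofPred_eq] using this
  have hconn : IsConnected {y : ℝ | (z, s, y) ∈ K} :=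
    ⟨hs, hconv.isPreconnected⟩
  have h := eq_Icc_of_connected_compact hconn hc
  exact ⟨_, _, csInf_le_csSup hs hc.bddBelow hc.bddAbove, h⟩

/-- One-dimensional Brunn–Minkowski: convex combinations of the endpoints of two slices stay in `K`.
-/
theorem concaveOn_slice_length (hK : Convex ℝ K) (hKc : IsCompact K) (z : Fin k → ℝ) :
    ConcaveOn ℝ {s | ∃ y, (z, s, y) ∈ K} (fun s => volume.real {y | (z, s, y) ∈ K}) := by
  have hcomb : ∀ {s₁ y₁ s₂ y₂ a b : ℝ}, (z, s₁, y₁) ∈ K → (z, s₂, y₂) ∈ K → 0 ≤ a → 0 ≤ b →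
      a + b = 1 → (z, a • s₁ + b • s₂, a • y₁ + b • y₂) ∈ K := by
    intro s₁ y₁ s₂ y₂ a b h₁ h₂ ha hb hab
    have := hK h₁ h₂ ha hb hab
    simpa only [Prod.smul_mk, Prod.mk_add_mk, ← add_smul, hab, one_smul] using this
  refine ⟨?_, ?_⟩
  · rintro s₁ ⟨y₁, h₁⟩ s₂ ⟨y₂, h₂⟩ a b ha hb hab
    exact ⟨_, hcomb h₁ h₂ ha hb hab⟩
  · intro s₁ hs₁ s₂ hs₂ a b ha hb hab
    obtain ⟨p₁, q₁, hpq₁, e₁⟩ := exists_slice_eq_Icc hK hKc hs₁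
    obtain ⟨p₂, q₂, hpq₂, e₂⟩ := exists_slice_eq_Icc hK hKc hs₂
    have hp₁ : (z, s₁, p₁) ∈ K := (e₁ ▸ Set.left_mem_Icc.2 hpq₁ : p₁ ∈ {y | (z, s₁, y) ∈ K})
    have hq₁ : (z, s₁, q₁) ∈ K := (e₁ ▸ Set.right_mem_Icc.2 hpq₁ : q₁ ∈ {y | (z, s₁, y) ∈ K})
    have hp₂ : (z, s₂, p₂) ∈ K := (e₂ ▸ Set.left_mem_Icc.2 hpq₂ : p₂ ∈ {y | (z, s₂, y) ∈ K})
    have hq₂ : (z, s₂, q₂) ∈ K := (e₂ ▸ Set.right_mem_Icc.2 hpq₂ : q₂ ∈ {y | (z, s₂, y) ∈ K})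
    have hp := hcomb hp₁ hp₂ ha hb hab
    have hq := hcomb hq₁ hq₂ ha hb hab
    obtain ⟨p, q, hpq, e⟩ := exists_slice_eq_Icc hK hKc ⟨_, hp⟩
    have hp' : a • p₁ + b • p₂ ∈ Set.Icc p q := e ▸ hp
    have hq' : a • q₁ + b • q₂ ∈ Set.Icc p q := e ▸ hq
    simp only [e₁, e₂, e, Real.volume_real_Icc_of_le, hpq, hpq₁, hpq₂, smul_eq_mul] at *
    nlinarith [hp'.1, hq'.2]

/-- Roundness applied to the longest chord, the whole slice; this is the hypothesis on `φ` in the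
one-dimensional estimate. -/
theorem RoundAlong.slice_length {c : ℝ} (hr : RoundAlong ((0, 0, 1) : (Fin k → ℝ) × ℝ × ℝ)
    (0, 1, 0) c K) (hK : Convex ℝ K) (hKc : IsCompact K) {z : Fin k → ℝ} {s : ℝ}
    (hs : ∃ y, (z, s, y) ∈ K) :
    (∃ y, (z, s - c * volume.real {y | (z, s, y) ∈ K} ^ 2, y) ∈ K) ∧
      ∃ y, (z, s + c * volume.real {y | (z, s, y) ∈ K} ^ 2, y) ∈ K := by
  obtain ⟨p, q, hpq, e⟩ := exists_slice_eq_Icc hK hKc hs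
  have hp : (z, s, p) ∈ K := (e ▸ Set.left_mem_Icc.2 hpq : p ∈ {y | (z, s, y) ∈ K})
  have hq : (z, s, q) ∈ K := (e ▸ Set.right_mem_Icc.2 hpq : q ∈ {y | (z, s, y) ∈ K})
  have := hr _ hp (q - p) (by linarith) (by simpa using hq)
  rw [e, Real.volume_real_Icc_of_le hpq]
  simp only [Prod.smul_mk, Prod.mk_add_mk, Prod.mk_sub_mk, smul_zero, add_zero, sub_zero,
    smul_eq_mul, mul_one, mul_zero] at this
  exact ⟨⟨_, this.2⟩, ⟨_, this.1⟩⟩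

theorem setIntegral_eq_integral_slice_length (hKc : IsCompact K) {f : ℝ → ℝ} {C : ℝ}
    (hf : Measurable f) (hfC : ∀ s, |f s| ≤ C) :
    ∫ v in K, f v.2.1 = ∫ z, ∫ s, f s * volume.real {y | (z, s, y) ∈ K} := by
  have hKm := hKc.measurableSet
  have hfi : IntegrableOn (fun v : (Fin k → ℝ) × ℝ × ℝ => f v.2.1) K := by
    refine Measure.integrableOn_of_bounded (M := C) hKc.measure_lt_top.ne
      (hf.comp measurable_snd.fst).aestronglyMeasurable
      (Filter.Eventually.of_forall fun s => hfC _)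
  have hfi' := (integrable_indicator_iff hKm).2 hfi
  rw [← integral_indicator hKm, Measure.volume_eq_prod, integral_prod _ hfi']
  refine integral_congr_ae ?_
  filter_upwards [hfi'.prod_right_ae] with z hz
  rw [Measure.volume_eq_prod, integral_prod _ hz]
  refine integral_congr_ae (Filter.Eventually.of_forall fun s => ?_)
  have hm : MeasurableSet {y | (z, s, y) ∈ K} :=
    hKm.preimage (measurable_const.prodMk (measurable_const.prodMk measurable_id))
  have : ∀ y, K.indicator (fun v : (Fin k → ℝ) × ℝ × ℝ => f v.2.1) (z, s, y)
      = {y | (z, s, y) ∈ K}.indicator (fun _ => f s) y := fun y => rfl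
  simp only [this]
  rw [integral_indicator hm, setIntegral_const, smul_eq_mul, mul_comm]

theorem abs_setIntegral_shift_sub_le {h : ℝ → ℝ} {c τ lo hi κ ρ : ℝ} {z₀ : Fin k → ℝ}
    (hK : Convex ℝ K) (hKc : IsCompact K)
    (hr : RoundAlong ((0, 0, 1) : (Fin k → ℝ) × ℝ × ℝ) (0, 1, 0) c K) (hc : 0 < c) (hτ : 0 < τ)
    (hlo : ∀ v ∈ K, lo ≤ v.2.1) (hhi : ∀ v ∈ K, v.2.1 + τ ≤ hi) (hρ : 0 ≤ ρ)
    (hz : ∀ v ∈ K, v.1 ∈ Metric.closedBall z₀ ρ)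
    (hh : Measurable h) (hh1 : ∀ s, |h s| ≤ 1) (hκ : 0 < κ)
    (hint : ∀ u v, lo ≤ u → u ≤ v → v ≤ hi → |∫ s in u..v, h s| ≤ κ) :
    |∫ v in K, (h (v.2.1 + τ) - h v.2.1)| ≤ (2 * ρ) ^ k * (4 * Real.pi * (τ / √c * √κ)) := by
  obtain ⟨Q, hQ⟩ := hKc.isBounded.exists_norm_le
  have hhτ : Measurable fun s => h (s + τ) := hh.comp (measurable_id.add_const τ)
  rw [setIntegral_eq_integral_slice_length (f := fun s => h (s + τ) - h s) (C := 2) hKc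
    (hhτ.sub hh)
    (fun s => (abs_sub _ _).trans (by linarith [hh1 s, hh1 (s + τ)]))]
  have hin : ∀ z, |∫ s, (h (s + τ) - h s) * volume.real {y | (z, s, y) ∈ K}|
      ≤ 4 * Real.pi * (τ / √c * √κ) := by
    intro z
    set φ : ℝ → ℝ := fun s => volume.real {y | (z, s, y) ∈ K} with hφ
    have hφm : Measurable φ := by
      have : MeasurableSet {p : ℝ × ℝ | (z, p.1, p.2) ∈ K} :=
        hKc.measurableSet.preimage (measurable_const.prodMk measurable_id)
      exact (measurable_measure_prodMk_left this).ennreal_toReal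
    have hφ0 : ∀ s, 0 ≤ φ s := fun s => measureReal_nonneg
    have hφQ : ∀ s, φ s ≤ 2 * |Q| := by
      intro s
      refine Real.volume_real_le_of_forall_sub_le (by positivity) fun x hx y hy => ?_
      have h1 := (norm_snd_le _).trans ((norm_snd_le _).trans (hQ _ hx))
      have h2 := (norm_snd_le _).trans ((norm_snd_le _).trans (hQ _ hy))
      simp only [Real.norm_eq_abs] at h1 h2
      linarith [abs_le.1 h1, abs_le.1 h2, le_abs_self Q]
    have hφI : ∀ s, s ∉ {s | ∃ y, (z, s, y) ∈ K} → φ s = 0 := by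
      intro s hs
      have : {y | (z, s, y) ∈ K} = ∅ := by
        ext y; simpa using fun hy => hs ⟨y, hy⟩
      simp [hφ, this]
    have key := (concaveOn_slice_length hK hKc z).abs_integral_increment_mul_le (c := c) (τ := τ)
      (lo := lo) (hi := hi) (κ := κ) (h := h) hφm hφ0 hφQ hφI
      (fun s hs => hr.slice_length hK hKc hs) hc hτ
      (fun s hs => by obtain ⟨y, hy⟩ := hs; exact hlo _ hy)
      (fun s hs => by obtain ⟨y, hy⟩ := hs; exact hhi _ hy) hh hh1 hκ hint
    have hintg : ∀ f : ℝ → ℝ, Measurable f → (∀ s, |f s| ≤ 1) →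
        Integrable fun s => f s * φ s := by
      intro f hf hf1
      have : IntegrableOn (fun s => f s * φ s) (Set.Icc lo hi) := by
        refine Measure.integrableOn_of_bounded (M := 2 * |Q|) (by simp)
          (hf.mul hφm).aestronglyMeasurable (Filter.Eventually.of_forall fun s => ?_)
        rw [norm_mul, Real.norm_eq_abs, Real.norm_eq_abs, abs_of_nonneg (hφ0 s)]
        calc |f s| * φ s ≤ 1 * (2 * |Q|) :=
              mul_le_mul (hf1 s) (hφQ s) (hφ0 s) zero_le_one
          _ = _ := one_mul _
      refine (integrableOn_iff_integrable_of_support_subset fun s hs => ?_).1 this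
      by_contra h'
      refine hs ?_
      have : φ s = 0 := hφI s fun ⟨y, hy⟩ => h' ⟨hlo _ hy, by linarith [hhi _ hy]⟩
      simp [this]
    -- The shift moves from `h`, which is rough, to `φ`, which is concave.
    have e1 : ∫ s, h (s + τ) * φ s = ∫ s, h s * φ (s - τ) := by
      rw [← integral_add_right_eq_self (fun s => h s * φ (s - τ)) τ]
      simp
    have hintτ : Integrable fun s => h s * φ (s - τ) := by
      have := (hintg _ hhτ fun s => hh1 _).comp_sub_right τ
      simpa using this
    have e2 : ∫ s, (h (s + τ) - h s) * φ s = ∫ s, (φ (s - τ) - φ s) * h s := by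
      have h1 : ∀ s, (φ (s - τ) - φ s) * h s = h s * φ (s - τ) - h s * φ s := fun s => by ring
      simp_rw [h1, sub_mul]
      rw [integral_sub (hintg _ hhτ fun s => hh1 _) (hintg _ hh hh1),
        integral_sub hintτ (hintg _ hh hh1), e1]
    rw [e2]
    exact key
  have hsup : ∀ z, z ∉ Metric.closedBall z₀ ρ →
      ∫ s, (h (s + τ) - h s) * volume.real {y | (z, s, y) ∈ K} = 0 := by
    intro z hz'
    have : ∀ s, {y | (z, s, y) ∈ K} = ∅ := by
      intro s; ext y; simpa using fun hy => hz' (hz _ hy)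
    simp [this]
  rw [← setIntegral_eq_integral_of_forall_compl_eq_zero hsup, ← Real.norm_eq_abs]
  have hvol : volume (Metric.closedBall z₀ ρ) = ENNReal.ofReal ((2 * ρ) ^ k) := by
    rw [Real.volume_pi_closedBall _ hρ, Fintype.card_fin]
  refine (norm_setIntegral_le_of_norm_le_const (by rw [hvol]; exact ENNReal.ofReal_lt_top)
    (fun z _ => hin z)).trans ?_
  rw [measureReal_def, hvol, ENNReal.toReal_ofReal (by positivity), mul_comm]

end Slices

/-! ### A slowly increasing density and a set of reals that follows it -/

/-- A strictly increasing function `ℝ → (0, 1)` with derivative `(1 + |u|) ^ (-3/2) / 4`. -/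
noncomputable def slowSigmoid (u : ℝ) : ℝ :=
  if 0 ≤ u then 1 - 1 / (2 * √(1 + u)) else 1 / (2 * √(1 - u))

theorem slowSigmoid_neg (u : ℝ) (hu : 0 ≤ u) : slowSigmoid (-u) = 1 - slowSigmoid u := by
  rcases hu.eq_or_lt with rfl | hu
  · norm_num [slowSigmoid]
  · simp [slowSigmoid, not_le.2 hu, hu.le]

theorem slowSigmoid_mem_Icc (u : ℝ) : slowSigmoid u ∈ Set.Icc (0 : ℝ) 1 := by
  have h : ∀ u : ℝ, 0 ≤ u → slowSigmoid u ∈ Set.Icc (0 : ℝ) 1 := by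
    intro u hu
    simp only [slowSigmoid, if_pos hu]
    have h1 : 1 ≤ √(1 + u) := Real.one_le_sqrt.2 (by linarith)
    have h2 : 1 / (2 * √(1 + u)) ≤ 1 := by
      rw [div_le_one (by positivity)]; linarith
    have h3 : 0 ≤ 1 / (2 * √(1 + u)) := by positivity
    exact ⟨by linarith, by linarith⟩
  rcases le_total 0 u with hu | hu
  · exact h u hu
  · have h1 := h (-u) (by linarith)
    have h2 := slowSigmoid_neg (-u) (by linarith)
    rw [neg_neg] at h2
    exact ⟨by linarith [h1.2], by linarith [h1.1]⟩

/-- The slope is at least `1 / (4 M ^ (3/2))` as long as `1 + |·| ≤ M`. On the positive side this is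
algebra in `√(1 + u)` and `√(1 + v)`; reflection and a split at `0` give the rest. -/
theorem slowSigmoid_sub_ge {u v M : ℝ} (huv : u ≤ v) (hu : 1 + |u| ≤ M) (hv : 1 + |v| ≤ M) :
    (v - u) / (4 * (M * √M)) ≤ slowSigmoid v - slowSigmoid u := by
  have h : ∀ u v : ℝ, 0 ≤ u → u ≤ v → 1 + v ≤ M →
      (v - u) / (4 * (M * √M)) ≤ slowSigmoid v - slowSigmoid u := by
    intro u v hu huv hv
    simp only [slowSigmoid, if_pos hu, if_pos (hu.trans huv)]
    have ha : 0 < √(1 + u) := Real.sqrt_pos.2 (by linarith)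
    have hab : √(1 + u) ≤ √(1 + v) := Real.sqrt_le_sqrt (by linarith)
    have hbM : √(1 + v) ≤ √M := Real.sqrt_le_sqrt hv
    have ea := Real.sq_sqrt (show 0 ≤ 1 + u by linarith)
    have eb := Real.sq_sqrt (show 0 ≤ 1 + v by linarith)
    have eM := Real.sq_sqrt (show 0 ≤ M by linarith)
    have e1 : v - u = √(1 + v) ^ 2 - √(1 + u) ^ 2 := by rw [ea, eb]; ring
    have e2 : M * √M = √M ^ 3 := by rw [pow_succ, eM]
    rw [e1, e2]
    generalize √(1 + u) = a at *
    generalize √(1 + v) = b at *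
    generalize √M = m at *
    have hb : 0 < b := by linarith
    have hm : 0 < m := by linarith
    have h1 : (b ^ 2 - a ^ 2) / (4 * m ^ 3) ≤ (b ^ 2 - a ^ 2) / (4 * b ^ 3) := by
      have : 0 ≤ b ^ 2 - a ^ 2 := by nlinarith
      gcongr
    refine h1.trans ?_
    have h2 : 1 - 1 / (2 * b) - (1 - 1 / (2 * a)) = (b - a) / (2 * a * b) := by
      field_simp; ring
    rw [h2, div_le_div_iff₀ (by positivity) (by positivity)]
    have h3 : 0 ≤ b - a := by linarith
    have h4 : a * (b + a) ≤ 2 * b ^ 2 := by nlinarith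
    have h5 : 0 ≤ (b - a) * b * (2 * b ^ 2 - a * (b + a)) :=
      mul_nonneg (mul_nonneg h3 hb.le) (by linarith)
    nlinarith
  rcases le_total 0 u with h0 | h0
  · exact h u v h0 huv (by rwa [abs_of_nonneg (h0.trans huv)] at hv)
  · have hn := slowSigmoid_neg (-u) (by linarith)
    rw [neg_neg] at hn
    rw [abs_of_nonpos h0] at hu
    rcases le_total v 0 with h1 | h1
    · have hn' := slowSigmoid_neg (-v) (by linarith)
      rw [neg_neg] at hn'
      have := h (-v) (-u) (by linarith) (by linarith) hu
      rw [show -u - -v = v - u by ring] at this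
      linarith
    · rw [abs_of_nonneg h1] at hv
      have h2 := h 0 (-u) le_rfl (by linarith) hu
      have h3 := h 0 v le_rfl h1 hv
      have h4 : slowSigmoid 0 = 1 / 2 := by norm_num [slowSigmoid]
      have h5 : (v - u) / (4 * (M * √M)) = (-u - 0) / (4 * (M * √M)) + (v - 0) / (4 * (M * √M)) := by
        ring
      linarith

theorem measurable_slowSigmoid : Measurable slowSigmoid := by
  unfold slowSigmoid
  exact Measurable.ite measurableSet_Ici (by fun_prop) (by fun_prop)

/-- A set which follows the density `g` on every cell of a partition of the half-line. -/
def cellSet (g : ℝ → ℝ) (c : ℕ → ℝ) : Set ℝ :=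
  ⋃ k, Set.Ico (c k) (c k + ∫ s in c k..c (k + 1), g s)

theorem measurableSet_cellSet (g : ℝ → ℝ) (c : ℕ → ℝ) : MeasurableSet (cellSet g c) :=
  MeasurableSet.iUnion fun _ => measurableSet_Ico

section CellSet

variable {g : ℝ → ℝ} {c : ℕ → ℝ}

theorem intervalIntegrable_of_mem_Icc (hg : Measurable g) (hg1 : ∀ s, g s ∈ Set.Icc (0 : ℝ) 1)
    (u v : ℝ) : IntervalIntegrable g volume u v := by
  rw [intervalIntegrable_iff]
  refine Measure.integrableOn_of_bounded (M := 1) (by simp) hg.aestronglyMeasurable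
    (Filter.Eventually.of_forall fun s => ?_)
  rw [Real.norm_eq_abs, abs_of_nonneg (hg1 s).1]
  exact (hg1 s).2

theorem intervalIntegral_mem_Icc (hg : Measurable g) (hg1 : ∀ s, g s ∈ Set.Icc (0 : ℝ) 1)
    {u v : ℝ} (huv : u ≤ v) : ∫ s in u..v, g s ∈ Set.Icc 0 (v - u) := by
  refine ⟨intervalIntegral.integral_nonneg huv fun s _ => (hg1 s).1, ?_⟩
  have := intervalIntegral.integral_mono_on huv (intervalIntegrable_of_mem_Icc hg hg1 u v)
    (intervalIntegrable_const (c := (1 : ℝ))) fun s _ => (hg1 s).2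
  simpa using this

/-- Since `g ≤ 1`, no piece overruns its cell, so only the piece of cell `k` matters there. -/
theorem indicator_cellSet_eq (hg : Measurable g) (hg1 : ∀ s, g s ∈ Set.Icc (0 : ℝ) 1)
    (hc : StrictMono c) (k : ℕ) {s : ℝ} (hs : s ∈ Set.Ico (c k) (c (k + 1))) :
    (cellSet g c).indicator (1 : ℝ → ℝ) s =
      (Set.Iio (c k + ∫ s in c k..c (k + 1), g s)).indicator 1 s := by
  by_cases h : s < c k + ∫ s in c k..c (k + 1), g s
  · rw [Set.indicator_of_mem (show s ∈ Set.Iio _ from h), Set.indicator_of_mem]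
    exact Set.mem_iUnion.2 ⟨k, hs.1, h⟩
  · rw [Set.indicator_of_notMem (show s ∉ Set.Iio _ from h), Set.indicator_of_notMem]
    intro hmem
    obtain ⟨j, hj⟩ := Set.mem_iUnion.1 hmem
    have h1 := (intervalIntegral_mem_Icc hg hg1 (hc (Nat.lt_succ_self j)).le).2
    have hj2 : s < c (j + 1) := by
      have := hj.2
      simp only [Nat.succ_eq_add_one] at h1
      linarith
    have hkj : k = j := by
      have h2 : k < j + 1 := hc.lt_iff_lt.1 (hs.1.trans_lt hj2)
      have h3 : j < k + 1 := hc.lt_iff_lt.1 (hj.1.trans_lt hs.2)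
      omega
    subst hkj
    exact h hj.2

theorem indicator_mem_Icc (S : Set ℝ) (s : ℝ) : S.indicator (1 : ℝ → ℝ) s ∈ Set.Icc (0 : ℝ) 1 := by
  by_cases h : s ∈ S <;> simp [h]

/-- Complete cells contribute zero, and the last partial cell at most its length. -/
theorem abs_integral_cellSet_sub_le (hg : Measurable g) (hg1 : ∀ s, g s ∈ Set.Icc (0 : ℝ) 1)
    (hc : StrictMono c) (h0 : c 0 = 0) (k : ℕ) {u : ℝ} (hu : u ∈ Set.Icc (c k) (c (k + 1))) :
    |∫ s in 0..u, ((cellSet g c).indicator (1 : ℝ → ℝ) s - g s)| ≤ c (k + 1) - c k := by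
  have hSm : Measurable ((cellSet g c).indicator (1 : ℝ → ℝ)) :=
    measurable_one.indicator (measurableSet_cellSet g c)
  have hS1 := indicator_mem_Icc (cellSet g c)
  have hi : ∀ u v, IntervalIntegrable
      (fun s => (cellSet g c).indicator (1 : ℝ → ℝ) s - g s) volume u v := fun u v =>
    (intervalIntegrable_of_mem_Icc hSm hS1 u v).sub (intervalIntegrable_of_mem_Icc hg hg1 u v)
  have hcell : ∀ j, ∫ s in c j..c (j + 1), ((cellSet g c).indicator (1 : ℝ → ℝ) s - g s) = 0 := by
    intro j
    have hlt := hc (Nat.lt_succ_self j)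
    simp only [Nat.succ_eq_add_one] at hlt
    have hI := intervalIntegral_mem_Icc hg hg1 hlt.le
    rw [intervalIntegral.integral_sub (intervalIntegrable_of_mem_Icc hSm hS1 _ _)
      (intervalIntegrable_of_mem_Icc hg hg1 _ _), sub_eq_zero,
      intervalIntegral.integral_of_le hlt.le, integral_Ioc_eq_integral_Ioo,
      ← integral_Ico_eq_integral_Ioo,
      setIntegral_congr_fun measurableSet_Ico fun s hs => indicator_cellSet_eq hg hg1 hc j hs,
      setIntegral_indicator measurableSet_Iio, Set.Ico_inter_Iio, min_eq_right (by linarith [hI.2])]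
    simp [hI.1]
  have hstart : ∀ j, ∫ s in 0..c j, ((cellSet g c).indicator (1 : ℝ → ℝ) s - g s) = 0 := by
    intro j
    induction j with
    | zero => rw [h0, intervalIntegral.integral_same]
    | succ j ih =>
      rw [← intervalIntegral.integral_add_adjacent_intervals (hi _ (c j)) (hi _ _), ih, hcell,
        add_zero]
  rw [← intervalIntegral.integral_add_adjacent_intervals (hi _ (c k)) (hi _ _), hstart, zero_add]
  have := intervalIntegral.norm_integral_le_of_norm_le_const (a := c k) (b := u) (C := 1)
    (f := fun s => (cellSet g c).indicator (1 : ℝ → ℝ) s - g s) (fun s _ => by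
      rw [Real.norm_eq_abs, abs_le]
      constructor <;> linarith [(hS1 s).1, (hS1 s).2, (hg1 s).1, (hg1 s).2])
  rw [Real.norm_eq_abs, one_mul, abs_of_nonneg (show 0 ≤ u - c k by linarith [hu.1])] at this
  linarith [hu.2]

end CellSet

/-- The fourth root of a natural number, scaled by `α`. -/
noncomputable def rootGrid (α : ℝ) (k : ℕ) : ℝ := α * √√(k : ℝ)

theorem rootGrid_strictMono {α : ℝ} (hα : 0 < α) : StrictMono (rootGrid α) := by
  intro i j hij
  refine mul_lt_mul_of_pos_left ?_ hα
  exact Real.sqrt_lt_sqrt (Real.sqrt_nonneg _)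
    (Real.sqrt_lt_sqrt (Nat.cast_nonneg _) (by exact_mod_cast hij))

theorem exists_rootGrid_cell {α u : ℝ} (hα : 0 < α) (hu : 0 ≤ u) :
    ∃ k, u ∈ Set.Icc (rootGrid α k) (rootGrid α (k + 1)) := by
  have h0 : 0 ≤ u / α := by positivity
  refine ⟨⌊(u / α) ^ 4⌋₊, ?_, ?_⟩
  · rw [rootGrid, mul_comm, ← le_div_iff₀ hα, Real.sqrt_le_left h0, Real.sqrt_le_left (by positivity)]
    exact (Nat.floor_le (by positivity)).trans_eq (by ring)
  · rw [rootGrid, mul_comm, ← div_le_iff₀ hα]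
    refine Real.le_sqrt_of_sq_le (Real.le_sqrt_of_sq_le ?_)
    have := (Nat.lt_floor_add_one ((u / α) ^ 4)).le
    push_cast
    exact le_trans (by ring_nf; rfl) this

theorem rootGrid_cell_length_le {α ε : ℝ} (hα : 0 < α) (hα1 : α ≤ 1) (hαε : 8 * α ≤ ε) {k : ℕ}
    {u : ℝ} (hu : u ∈ Set.Icc (rootGrid α k) (rootGrid α (k + 1))) :
    rootGrid α (k + 1) - rootGrid α k ≤ ε / (1 + |u|) ^ 3 := by
  have hu0 : 0 ≤ u := le_trans (by unfold rootGrid; positivity) hu.1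
  rw [abs_of_nonneg hu0]
  have hx : 0 ≤ √√(k : ℝ) := Real.sqrt_nonneg _
  have hy : 1 ≤ √√((k + 1 : ℕ) : ℝ) :=
    Real.one_le_sqrt.2 (Real.one_le_sqrt.2 (by push_cast; linarith [Nat.cast_nonneg (α := ℝ) k]))
  have hxy : √√(k : ℝ) ≤ √√((k + 1 : ℕ) : ℝ) :=
    Real.sqrt_le_sqrt (Real.sqrt_le_sqrt (by push_cast; linarith))
  have ex : √√(k : ℝ) ^ 4 = k := by
    rw [show (4 : ℕ) = 2 * 2 from rfl, pow_mul, Real.sq_sqrt (Real.sqrt_nonneg _),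
      Real.sq_sqrt (Nat.cast_nonneg _)]
  have ey : √√((k + 1 : ℕ) : ℝ) ^ 4 = k + 1 := by
    rw [show (4 : ℕ) = 2 * 2 from rfl, pow_mul, Real.sq_sqrt (Real.sqrt_nonneg _),
      Real.sq_sqrt (Nat.cast_nonneg _)]
    push_cast; rfl
  have hu2 := hu.2
  unfold rootGrid at hu2 ⊢
  generalize √√(k : ℝ) = x at *
  generalize √√((k + 1 : ℕ) : ℝ) = y at *
  -- From `y ^ 4 - x ^ 4 = 1`: fourth roots give gaps of the order of the inverse cube.
  have h1 : (y - x) * y ^ 3 ≤ 1 := by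
    have h2 : (y - x) * (y ^ 3 + y ^ 2 * x + y * x ^ 2 + x ^ 3) = 1 := by
      linear_combination ey - ex
    have h3 : 0 ≤ (y - x) * (y ^ 2 * x + y * x ^ 2 + x ^ 3) :=
      mul_nonneg (by linarith) (by positivity)
    linarith
  rw [le_div_iff₀ (by positivity)]
  -- Because `u ≤ α y ≤ y` and `1 ≤ y`. Cubing the `2` produces the `8` in `8 * α ≤ ε`.
  have h4 : 1 + u ≤ 2 * y := by nlinarith
  calc (α * y - α * x) * (1 + u) ^ 3 ≤ (α * y - α * x) * (2 * y) ^ 3 := by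
        have : 0 ≤ α * y - α * x := by nlinarith
        gcongr
    _ = 8 * α * ((y - x) * y ^ 3) := by ring
    _ ≤ 8 * α * 1 := by gcongr
    _ ≤ ε := by linarith

theorem exists_cellSet_half_line {g : ℝ → ℝ} (hg : Measurable g)
    (hg1 : ∀ s, g s ∈ Set.Icc (0 : ℝ) 1) {ε : ℝ} (hε : 0 < ε) :
    ∃ S : Set ℝ, MeasurableSet S ∧ ∀ u, 0 ≤ u →
      |∫ s in 0..u, (S.indicator (1 : ℝ → ℝ) s - g s)| ≤ ε / (1 + |u|) ^ 3 := by
  set α : ℝ := min 1 (ε / 8)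
  have hα : 0 < α := lt_min one_pos (by positivity)
  have hαε : 8 * α ≤ ε := by linarith [min_le_right 1 (ε / 8)]
  refine ⟨cellSet g (rootGrid α), measurableSet_cellSet _ _, fun u hu => ?_⟩
  obtain ⟨k, hk⟩ := exists_rootGrid_cell hα hu
  exact (abs_integral_cellSet_sub_le hg hg1 (rootGrid_strictMono hα) (by simp [rootGrid]) k hk).trans
    (rootGrid_cell_length_le hα (min_le_left _ _) hαε hk)

/-- Every density `g : ℝ → [0, 1]` is followed by a measurable set at a scale that shrinks at
infinity. -/
theorem exists_set_follows_density {g : ℝ → ℝ} (hg : Measurable g)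
    (hg1 : ∀ s, g s ∈ Set.Icc (0 : ℝ) 1) {ε : ℝ} (hε : 0 < ε) :
    ∃ S : Set ℝ, MeasurableSet S ∧ ∀ u v,
      |∫ s in u..v, (S.indicator (1 : ℝ → ℝ) s - g s)| ≤
        ε / (1 + |u|) ^ 3 + ε / (1 + |v|) ^ 3 := by
  obtain ⟨P, hPm, hP⟩ := exists_cellSet_half_line hg hg1 hε
  obtain ⟨N, hNm, hN⟩ := exists_cellSet_half_line (g := fun s => g (-s)) (hg.comp measurable_neg)
    (fun s => hg1 (-s)) hε
  set S : Set ℝ := (P ∩ Set.Ici 0) ∪ ((fun s => -s) ⁻¹' N ∩ Set.Iio 0) with hS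
  have hSm : MeasurableSet S := (hPm.inter measurableSet_Ici).union
    ((hNm.preimage measurable_neg).inter measurableSet_Iio)
  have hpos : ∀ s, 0 ≤ s → S.indicator (1 : ℝ → ℝ) s = P.indicator 1 s := by
    intro s hs
    have : s ∈ S ↔ s ∈ P := by simp [hS, hs]
    by_cases h : s ∈ P <;> simp [this, h]
  have hneg : ∀ s, s < 0 → S.indicator (1 : ℝ → ℝ) s = N.indicator 1 (-s) := by
    intro s hs
    have : s ∈ S ↔ -s ∈ N := by simp [hS, hs]
    by_cases h : -s ∈ N <;> simp [this, h]
  have hH : ∀ u, |∫ s in 0..u, (S.indicator (1 : ℝ → ℝ) s - g s)| ≤ ε / (1 + |u|) ^ 3 := by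
    intro u
    rcases le_or_gt 0 u with hu | hu
    · rw [intervalIntegral.integral_congr (g := fun s => P.indicator (1 : ℝ → ℝ) s - g s)]
      · exact hP u hu
      · intro s hs
        rw [Set.uIcc_of_le hu] at hs
        simp only [hpos s hs.1]
    · have h1 := hN (-u) (by linarith)
      have h2 : ∫ s in 0..-u, (N.indicator (1 : ℝ → ℝ) s - g (-s)) =
          ∫ s in u..0, (N.indicator (1 : ℝ → ℝ) (-s) - g s) := by
        have := intervalIntegral.integral_comp_neg (a := u) (b := 0)
          (fun s => N.indicator (1 : ℝ → ℝ) s - g (-s))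
        simp only [neg_neg, neg_zero] at this
        exact this.symm
      have h3 : ∫ s in u..0, (N.indicator (1 : ℝ → ℝ) (-s) - g s) =
          ∫ s in u..0, (S.indicator (1 : ℝ → ℝ) s - g s) := by
        rw [intervalIntegral.integral_of_le hu.le, intervalIntegral.integral_of_le hu.le,
          integral_Ioc_eq_integral_Ioo, integral_Ioc_eq_integral_Ioo]
        exact setIntegral_congr_fun measurableSet_Ioo fun s hs => by simp only [hneg s hs.2]
      rw [intervalIntegral.integral_symm, abs_neg, ← h3, ← h2]
      rwa [abs_neg] at h1
  refine ⟨S, hSm, fun u v => ?_⟩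
  have hi : ∀ u v, IntervalIntegrable
      (fun s => S.indicator (1 : ℝ → ℝ) s - g s) volume u v := fun u v =>
    (intervalIntegrable_of_mem_Icc (measurable_one.indicator hSm) (indicator_mem_Icc S) u v).sub
      (intervalIntegrable_of_mem_Icc hg hg1 u v)
  rw [← intervalIntegral.integral_interval_sub_left (hi 0 v) (hi 0 u)]
  refine (abs_sub _ _).trans ?_
  linarith [hH u, hH v]

/-! ### Unions of round bodies and the slab test set -/

section Round

variable {V : Type*} [AddCommGroup V] [Module ℝ V] {u e : V} {c : ℝ}

/-- The room `c ℓ²` is quadratic in length, so magnification by `r` divides the constant by `r`. -/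
theorem RoundAlong.image_smul_add {K : Set V} (h : RoundAlong u e c K) {r : ℝ} (hr : 0 < r)
    (x : V) : RoundAlong u e (c / r) ((fun v => r • v + x) '' K) := by
  rintro _ ⟨a, ha, rfl⟩ ℓ hℓ ⟨b, hb, hab⟩
  have hb' : b = a + (ℓ / r) • u := by
    have h1 : r • b = r • (a + (ℓ / r) • u) := by
      rw [smul_add, smul_smul, mul_div_cancel₀ _ hr.ne']
      simp only at hab
      have : r • b + x = (r • a + ℓ • u) + x := by rw [hab]; abel
      exact add_right_cancel this
    exact smul_right_injective V hr.ne' h1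
  obtain ⟨h1, h2⟩ := h a ha (ℓ / r) (by positivity) (hb' ▸ hb)
  have e1 : r * (ℓ / r / 2) = ℓ / 2 := by field_simp
  have e2 : r * (c * (ℓ / r) ^ 2) = c / r * ℓ ^ 2 := by field_simp
  refine ⟨⟨_, h1, ?_⟩, ⟨_, h2, ?_⟩⟩
  · simp only [smul_add, smul_smul, e1, e2]; abel
  · simp only [smul_add, smul_sub, smul_smul, e1, e2]; abel

theorem RoundAlong.biInter {ι : Type*} {K : ι → Set V} {t : Set ι}
    (h : ∀ i ∈ t, RoundAlong u e c (K i)) : RoundAlong u e c (⋂ i ∈ t, K i) := by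
  intro a ha ℓ hℓ hb
  simp only [Set.mem_iInter] at *
  exact ⟨fun i hi => (h i hi a (ha i hi) ℓ hℓ (hb i hi)).1,
    fun i hi => (h i hi a (ha i hi) ℓ hℓ (hb i hi)).2⟩

end Round

instance isAddHaarMeasure_volume_pi_prod_prod (k : ℕ) :
    (volume : Measure ((Fin k → ℝ) × ℝ × ℝ)).IsAddHaarMeasure :=
  Measure.prod.instIsAddHaarMeasure volume volume

section Union

variable {k : ℕ} {ι : Type*} [Fintype ι] {K : ι → Set ((Fin k → ℝ) × ℝ × ℝ)}

/-- Inclusion–exclusion: each intersection is again compact, convex and round with the same `c`, and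
there are at most `2 ^ card ι` of them. -/
theorem abs_setIntegral_iUnion_shift_sub_le {h : ℝ → ℝ} {c τ lo hi κ ρ : ℝ} {z₀ : Fin k → ℝ}
    (hK : ∀ i, Convex ℝ (K i)) (hKc : ∀ i, IsCompact (K i))
    (hr : ∀ i, RoundAlong ((0, 0, 1) : (Fin k → ℝ) × ℝ × ℝ) (0, 1, 0) c (K i))
    (hc : 0 < c) (hτ : 0 < τ)
    (hlo : ∀ i, ∀ v ∈ K i, lo ≤ v.2.1) (hhi : ∀ i, ∀ v ∈ K i, v.2.1 + τ ≤ hi) (hρ : 0 ≤ ρ)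
    (hz : ∀ i, ∀ v ∈ K i, v.1 ∈ Metric.closedBall z₀ ρ)
    (hh : Measurable h) (hh1 : ∀ s, |h s| ≤ 1) (hκ : 0 < κ)
    (hint : ∀ u v, lo ≤ u → u ≤ v → v ≤ hi → |∫ s in u..v, h s| ≤ κ) :
    |∫ v in ⋃ i, K i, (h (v.2.1 + τ) - h v.2.1)| ≤
      2 ^ Fintype.card ι * ((2 * ρ) ^ k * (4 * Real.pi * (τ / √c * √κ))) := by
  classical
  have hhm : Measurable fun v : (Fin k → ℝ) × ℝ × ℝ => h (v.2.1 + τ) - h v.2.1 :=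
    (hh.comp (measurable_snd.fst.add_const τ)).sub (hh.comp measurable_snd.fst)
  have hU : (⋃ i, K i) = ⋃ i ∈ (Finset.univ : Finset ι), K i := by simp
  have hB : 0 ≤ (2 * ρ) ^ k * (4 * Real.pi * (τ / √c * √κ)) := by positivity
  rw [hU, integral_biUnion_eq_sum_powerset (fun i _ => (hKc i).measurableSet) (fun i _ => ?_)]
  · refine (Finset.abs_sum_le_sum_abs _ _).trans ?_
    have hle : ∀ t ∈ Finset.filter (fun t => t.Nonempty) (Finset.univ : Finset ι).powerset,
        |(-1 : ℝ) ^ (t.card + 1) • ∫ v in ⋂ i ∈ t, K i, (h (v.2.1 + τ) - h v.2.1)| ≤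
          (2 * ρ) ^ k * (4 * Real.pi * (τ / √c * √κ)) := by
      intro t ht
      obtain ⟨i, hi⟩ := (Finset.mem_filter.1 ht).2
      have hsub : (⋂ i ∈ t, K i) ⊆ K i := Set.biInter_subset_of_mem hi
      rw [smul_eq_mul, abs_mul, abs_pow, abs_neg, abs_one, one_pow, one_mul]
      exact abs_setIntegral_shift_sub_le (convex_iInter₂ fun i _ => hK i)
        ((hKc i).of_isClosed_subset (isClosed_biInter fun i _ => (hKc i).isClosed) hsub)
        (RoundAlong.biInter (t := (t : Set ι)) fun i _ => hr i) hc hτ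
        (fun v hv => hlo i v (hsub hv)) (fun v hv => hhi i v (hsub hv)) hρ
        (fun v hv => hz i v (hsub hv)) hh hh1 hκ hint
    refine (Finset.sum_le_card_nsmul _ _ _ hle).trans ?_
    rw [nsmul_eq_mul]
    refine mul_le_mul_of_nonneg_right ?_ hB
    have : (Finset.filter (fun t => Finset.Nonempty t) (Finset.univ : Finset ι).powerset).card ≤
        2 ^ Fintype.card ι := by
      refine (Finset.card_filter_le _ _).trans ?_
      rw [Finset.card_powerset, Finset.card_univ]
    exact_mod_cast this
  · refine Measure.integrableOn_of_bounded (M := 2) (hKc i).measure_lt_top.ne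
      hhm.aestronglyMeasurable (Filter.Eventually.of_forall fun v => ?_)
    exact (abs_sub _ _).trans (by linarith [hh1 v.2.1, hh1 (v.2.1 + τ)])

open scoped Pointwise in
theorem volume_real_image_smul_add (E : Set ((Fin k → ℝ) × ℝ × ℝ)) {r : ℝ} (hr : 0 < r)
    (x : (Fin k → ℝ) × ℝ × ℝ) :
    volume.real ((fun v => r • v + x) '' E) = r ^ (k + 2) * volume.real E := by
  have h1 : (fun v => r • v + x) '' E = (fun v => v + x) '' (r • E) := by
    rw [← Set.image_smul, Set.image_image]
  have hfr : Module.finrank ℝ ((Fin k → ℝ) × ℝ × ℝ) = k + 2 := by simp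
  rw [h1, measureReal_def, Set.image_add_right,
    measure_preimage_add_right, Measure.addHaar_smul, hfr, ENNReal.toReal_mul, ENNReal.toReal_ofReal (abs_nonneg _),
    abs_of_pos (by positivity), measureReal_def]

/-- A slab set on which the measure of every large copy of a finite union of round convex bodies
strictly increases when the copy is shifted across the slabs. -/
theorem exists_slab_set_strict_increase {c : ℝ}
    (hK : ∀ i, Convex ℝ (K i)) (hKc : ∀ i, IsCompact (K i))
    (hr : ∀ i, RoundAlong ((0, 0, 1) : (Fin k → ℝ) × ℝ × ℝ) (0, 1, 0) c (K i))
    (hc : 0 < c) (hvol : 0 < volume.real (⋃ i, K i)) :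
    ∃ S : Set ℝ, MeasurableSet S ∧ ∀ (r : ℝ) (x : (Fin k → ℝ) × ℝ × ℝ) (τ : ℝ),
      1 ≤ r → 0 < τ → τ ≤ 1 →
      volume.real (((fun v => r • v + x) '' ⋃ i, K i) ∩ {v | v.2.1 ∈ S}) <
        volume.real (((fun v => r • v + x) '' ⋃ i, K i) ∩ {v | v.2.1 + τ ∈ S}) := by
  have hEc : IsCompact (⋃ i, K i) := isCompact_iUnion hKc
  obtain ⟨R, hR1, hR⟩ : ∃ R : ℝ, 1 ≤ R ∧ ∀ v ∈ ⋃ i, K i, ‖v‖ ≤ R := by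
    obtain ⟨R, hR⟩ := hEc.isBounded.exists_norm_le
    exact ⟨max 1 R, le_max_left _ _, fun v hv => (hR v hv).trans (le_max_right _ _)⟩
  set C : ℝ := 2 ^ Fintype.card ι * ((2 * R) ^ k * (4 * Real.pi)) with hC
  have hC0 : 0 < C := by positivity
  -- With this `q` the error constant `C * q` is an eighth of the volume, half of the quarter that
  -- the gain provides.
  set q : ℝ := volume.real (⋃ i, K i) / (8 * C) with hq
  have hq0 : 0 < q := by positivity
  have hCq : C * q = volume.real (⋃ i, K i) / 8 := by rw [hq]; field_simp
  clear_value q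
  set W : ℝ := 2 * R + 3 with hW
  have hW0 : 0 < W := by positivity
  obtain ⟨S, hSm, hS⟩ := exists_set_follows_density measurable_slowSigmoid slowSigmoid_mem_Icc
    (ε := c * q ^ 2 / (2 * W ^ 3)) (by positivity)
  refine ⟨S, hSm, fun r x τ hr1 hτ hτ1 => ?_⟩
  have hr0 : 0 < r := by linarith
  set A : Set ((Fin k → ℝ) × ℝ × ℝ) := (fun v => r • v + x) '' ⋃ i, K i with hA
  have hcont : Continuous fun v : (Fin k → ℝ) × ℝ × ℝ => r • v + x := by fun_prop
  have hAc : IsCompact A := hEc.image hcont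
  have hAU : A = ⋃ i, (fun v => r • v + x) '' K i := by rw [hA, Set.image_iUnion]
  set σ : ℝ := x.2.1 with hσ
  have hs : ∀ v ∈ A, |v.2.1 - σ| ≤ r * R := by
    rintro _ ⟨v, hv, rfl⟩
    have h1 : ‖v.2.1‖ ≤ R := (norm_fst_le _).trans ((norm_snd_le _).trans (hR v hv))
    simp only [Prod.snd_add, Prod.smul_snd, Prod.fst_add, Prod.smul_fst, smul_eq_mul, hσ,
      add_sub_cancel_right, abs_mul, abs_of_pos hr0]
    exact mul_le_mul_of_nonneg_left h1 hr0.le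
  have hz : ∀ v ∈ A, v.1 ∈ Metric.closedBall x.1 (r * R) := by
    rintro _ ⟨v, hv, rfl⟩
    have h1 : ‖v.1‖ ≤ R := (norm_fst_le _).trans (hR v hv)
    simp only [Prod.fst_add, Prod.smul_fst, mem_closedBall_iff_norm, add_sub_cancel_right,
      norm_smul, Real.norm_eq_abs, abs_of_pos hr0]
    exact mul_le_mul_of_nonneg_left h1 hr0.le
  set lo : ℝ := σ - r * R with hlo
  set hi : ℝ := σ + r * R + 1 with hhi
  set M : ℝ := 2 + |σ| + r * R with hM
  have hrR : 0 < r * R := by positivity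
  have hM0 : 0 < M := by positivity
  set h : ℝ → ℝ := fun s => S.indicator (1 : ℝ → ℝ) s - slowSigmoid s with hh
  have hSi : Measurable (S.indicator (1 : ℝ → ℝ)) := measurable_one.indicator hSm
  have hhm : Measurable h := hSi.sub measurable_slowSigmoid
  have hh1 : ∀ s, |h s| ≤ 1 := by
    intro s
    have h1 := indicator_mem_Icc S s
    have h2 := slowSigmoid_mem_Icc s
    exact abs_le.2 ⟨by simp only [hh]; linarith [h1.1, h2.2], by simp only [hh]; linarith [h1.2, h2.1]⟩
  -- Chosen so that, with roundness `c / r`, `√(κ r / c) = q r² / M ^ (3/2)`. Together with the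
  -- factor `(2 r R) ^ k`, the error then scales in `r` and `M` exactly as the gain does.
  set κ : ℝ := c * q ^ 2 * r ^ 3 / M ^ 3 with hκ
  have hκ0 : 0 < κ := by positivity
  have hcell : ∀ u, lo ≤ u → u ≤ hi →
      c * q ^ 2 / (2 * W ^ 3) / (1 + |u|) ^ 3 ≤ κ / 2 := by
    intro u h1 h2
    -- Over the range of the copy, `M` and `1 + |u|` are comparable up to the factor `W * r`; this
    -- is what `ε` with `W ^ 3` was prepared for.
    have h3 : |σ| ≤ |u| + r * R + 1 := by
      rw [abs_le]
      constructor
      · linarith [neg_abs_le u]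
      · linarith [le_abs_self u]
    have h4 : M ≤ W * r * (1 + |u|) := by
      have h5 : 0 ≤ |u| := abs_nonneg u
      have : W * r * (1 + |u|) = 2 * (r * R) + 3 * r + W * r * |u| := by rw [hW]; ring
      have h6 : 1 * |u| ≤ W * r * |u| := mul_le_mul_of_nonneg_right (by nlinarith) h5
      linarith
    have h7 : M ^ 3 ≤ (W * r * (1 + |u|)) ^ 3 := by gcongr
    rw [hκ, div_div, div_div, div_le_div_iff₀ (by positivity) (by positivity)]
    have : c * q ^ 2 * (M ^ 3 * 2) ≤ c * q ^ 2 * ((W * r * (1 + |u|)) ^ 3 * 2) := by gcongr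
    refine this.trans_eq ?_
    ring
  have hint : ∀ u v, lo ≤ u → u ≤ v → v ≤ hi → |∫ s in u..v, h s| ≤ κ := by
    intro u v h1 h2 h3
    refine (hS u v).trans ?_
    linarith [hcell u h1 (h2.trans h3), hcell v (h1.trans h2) h3]
  have herr : |∫ v in A, (h (v.2.1 + τ) - h v.2.1)| ≤
      C * q * (r ^ (k + 2) * τ / (M * √M)) := by
    rw [hAU]
    refine (abs_setIntegral_iUnion_shift_sub_le (c := c / r) (lo := lo) (hi := hi) (κ := κ)
      (ρ := r * R) (z₀ := x.1) (fun i => ?_) (fun i => (hKc i).image hcont)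
      (fun i => (hr i).image_smul_add hr0 x) (by positivity) hτ ?_ ?_ hrR.le ?_ hhm hh1 hκ0
      hint).trans_eq ?_
    · simpa only [add_comm] using (hK i).affinity x r
    · intro i v hv
      have := hs v (hAU ▸ Set.mem_iUnion.2 ⟨i, hv⟩)
      linarith [(abs_le.1 this).1]
    · intro i v hv
      have := hs v (hAU ▸ Set.mem_iUnion.2 ⟨i, hv⟩)
      linarith [(abs_le.1 this).2]
    · intro i v hv
      exact hz v (hAU ▸ Set.mem_iUnion.2 ⟨i, hv⟩)
    · have e1 : τ / √(c / r) * √κ = τ * q * (r ^ 2 / (M * √M)) := by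
        have e2 : κ = (c / r) * (q * (r ^ 2 / (M * √M))) ^ 2 := by
          rw [hκ, mul_pow, div_pow, mul_pow, Real.sq_sqrt hM0.le]
          field_simp
        have h0 : 0 < √(c / r) := Real.sqrt_pos.2 (by positivity)
        rw [e2, Real.sqrt_mul (by positivity), Real.sqrt_sq (by positivity)]
        field_simp
      rw [e1, hC]
      ring
  have hbd : ∀ f : ℝ → ℝ, Measurable f → (∀ s, |f s| ≤ 2) →
      IntegrableOn (fun v : (Fin k → ℝ) × ℝ × ℝ => f v.2.1) A := fun f hf hf1 =>
    Measure.integrableOn_of_bounded (M := 2) hAc.measure_lt_top.ne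
      (hf.comp measurable_snd.fst).aestronglyMeasurable
      (Filter.Eventually.of_forall fun v => hf1 _)
  have hshift : ∀ f : ℝ → ℝ, Measurable f → Measurable fun s => f (s + τ) := fun f hf =>
    hf.comp (measurable_id.add_const τ)
  have hmain : volume.real A * (τ / (4 * (M * √M))) ≤
      ∫ v in A, (slowSigmoid (v.2.1 + τ) - slowSigmoid v.2.1) := by
    rw [← smul_eq_mul, ← setIntegral_const]
    refine setIntegral_mono_on (integrableOn_const hAc.measure_lt_top.ne)
      (hbd (fun s => slowSigmoid (s + τ) - slowSigmoid s)
        ((hshift _ measurable_slowSigmoid).sub measurable_slowSigmoid) fun s => ?_)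
      hAc.measurableSet fun v hv => ?_
    · have h1 := slowSigmoid_mem_Icc s
      have h2 := slowSigmoid_mem_Icc (s + τ)
      exact abs_le.2 ⟨by linarith [h1.2, h2.1], by linarith [h1.1, h2.2]⟩
    · have h1 := hs v hv
      have h2 : |v.2.1| ≤ |σ| + r * R := by
        have := abs_add_le (v.2.1 - σ) σ
        rw [sub_add_cancel] at this
        linarith
      have h3 : |v.2.1 + τ| ≤ |σ| + r * R + 1 :=
        (abs_add_le _ _).trans (by rw [abs_of_pos hτ]; linarith)
      have := slowSigmoid_sub_ge (u := v.2.1) (v := v.2.1 + τ) (M := M) (by linarith)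
        (by linarith) (by linarith)
      simpa using this
  have hind : ∀ τ' : ℝ, volume.real (A ∩ {v | v.2.1 + τ' ∈ S}) =
      ∫ v in A, S.indicator (1 : ℝ → ℝ) (v.2.1 + τ') := by
    intro τ'
    have hm : MeasurableSet {v : (Fin k → ℝ) × ℝ × ℝ | v.2.1 + τ' ∈ S} :=
      hSm.preimage (measurable_snd.fst.add_const τ')
    have h1 : ∀ v : (Fin k → ℝ) × ℝ × ℝ, S.indicator (1 : ℝ → ℝ) (v.2.1 + τ') =
        {v : (Fin k → ℝ) × ℝ × ℝ | v.2.1 + τ' ∈ S}.indicator (fun _ => (1 : ℝ)) v := fun v => rfl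
    simp_rw [h1]
    rw [setIntegral_indicator hm, setIntegral_const, smul_eq_mul, mul_one]
  have hS0 := hind 0
  simp only [add_zero] at hS0
  have hSi1 : ∀ s, |S.indicator (1 : ℝ → ℝ) s| ≤ 2 := fun s => by
    have := indicator_mem_Icc S s
    exact abs_le.2 ⟨by linarith [this.1], by linarith [this.2]⟩
  have hsplit : (∫ v in A, S.indicator (1 : ℝ → ℝ) (v.2.1 + τ)) -
      ∫ v in A, S.indicator (1 : ℝ → ℝ) v.2.1
      = (∫ v in A, (slowSigmoid (v.2.1 + τ) - slowSigmoid v.2.1)) +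
        ∫ v in A, (h (v.2.1 + τ) - h v.2.1) := by
    rw [← integral_sub (hbd (fun s => S.indicator (1 : ℝ → ℝ) (s + τ)) (hshift _ hSi)
      fun s => hSi1 _) (hbd _ hSi hSi1), ← integral_add]
    · refine integral_congr_ae (Filter.Eventually.of_forall fun v => ?_)
      simp only [hh]; ring
    · refine hbd (fun s => slowSigmoid (s + τ) - slowSigmoid s)
        ((hshift _ measurable_slowSigmoid).sub measurable_slowSigmoid) fun s => ?_
      have h1 := slowSigmoid_mem_Icc s
      have h2 := slowSigmoid_mem_Icc (s + τ)
      exact abs_le.2 ⟨by linarith [h1.2, h2.1], by linarith [h1.1, h2.2]⟩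
    · refine hbd (fun s => h (s + τ) - h s) ((hshift _ hhm).sub hhm) fun s => ?_
      exact (abs_sub _ _).trans (by linarith [hh1 s, hh1 (s + τ)])
  rw [hind τ, hS0, ← sub_pos, hsplit]
  rw [hA, volume_real_image_smul_add _ hr0 x] at hmain
  rw [hCq] at herr
  have hpos : 0 < volume.real (⋃ i, K i) * (r ^ (k + 2) * τ / (M * √M)) := by positivity
  have e1 : r ^ (k + 2) * volume.real (⋃ i, K i) * (τ / (4 * (M * √M))) =
      volume.real (⋃ i, K i) * (r ^ (k + 2) * τ / (M * √M)) / 4 := by field_simp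
  rw [e1] at hmain
  rw [← hA] at hmain
  have := (abs_le.1 herr).1
  linarith

end Union

/-! ### The remaining test sets, and reconstruction in product coordinates -/

theorem strictMono_of_forall_lt_add {f : ℝ → ℝ}
    (h : ∀ t τ, 0 < τ → τ ≤ 1 → f t < f (t + τ)) : StrictMono f := by
  intro u v huv
  obtain ⟨n, hn⟩ := exists_nat_ge (v - u)
  have hδ : 0 < (v - u) / (n + 1) := div_pos (by linarith) (by positivity)
  have hδ1 : (v - u) / (n + 1) ≤ 1 := (div_le_one (by positivity)).2 (by linarith)
  have key : ∀ m : ℕ, f u < f (u + (m + 1) * ((v - u) / (n + 1))) := by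
    intro m
    induction m with
    | zero => simpa using h u _ hδ hδ1
    | succ m ih =>
      refine ih.trans ((h _ _ hδ hδ1).trans_eq ?_)
      congr 1
      push_cast
      ring
  refine (key n).trans_eq ?_
  congr 1
  field_simp
  ring

section

variable {k : ℕ} {E : Set ((Fin k → ℝ) × ℝ × ℝ)}

theorem volume_image_smul_add_inter (r : ℝ) (x v : (Fin k → ℝ) × ℝ × ℝ)
    (T : Set ((Fin k → ℝ) × ℝ × ℝ)) :
    volume (((fun w => r • w + (x + v)) '' E) ∩ T) =
      volume (((fun w => r • w + x) '' E) ∩ {w | w + v ∈ T}) := by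
  have : (((fun w => r • w + x) '' E) ∩ {w | w + v ∈ T}) =
      (fun w => w + v) ⁻¹' (((fun w => r • w + (x + v)) '' E) ∩ T) := by
    ext w
    simp only [Set.mem_inter_iff, Set.mem_image, Set.mem_ofPred_eq, Set.mem_preimage, ← add_assoc,
      add_left_inj]
  rw [this, measure_preimage_add_right]

/-- The part of space above the graph of a rapidly oscillating tangent function. -/
def aboveTan (b : ℝ) (ℓ : (Fin k → ℝ) × ℝ × ℝ →L[ℝ] ℝ) : Set ((Fin k → ℝ) × ℝ × ℝ) :=
  {w | Real.tan (b * w.2.1) < ℓ w}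

theorem measurableSet_aboveTan (b : ℝ) (ℓ : (Fin k → ℝ) × ℝ × ℝ →L[ℝ] ℝ) :
    MeasurableSet (aboveTan b ℓ) := by
  refine measurableSet_lt ?_ ℓ.continuous.measurable
  simp_rw [Real.tan_eq_sin_div_cos]
  fun_prop

/-- `tan (π s / ρ)` has period `ρ` and takes every value in a period. The nonzero cosine gives
continuity there and excludes the poles, where `Real.tan` is `0` by convention. -/
theorem exists_tan_eq {ρ : ℝ} (hρ : 0 < ρ) (s a : ℝ) :
    ∃ δ, 0 ≤ δ ∧ δ < ρ ∧ Real.tan (Real.pi / ρ * (s + δ)) = a ∧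
      Real.cos (Real.pi / ρ * (s + δ)) ≠ 0 := by
  have hπ := Real.pi_pos
  set n : ℤ := ⌈(Real.pi / ρ * s - Real.arctan a) / Real.pi⌉ with hn
  have h1 := Int.le_ceil ((Real.pi / ρ * s - Real.arctan a) / Real.pi)
  have h2 := Int.ceil_lt_add_one ((Real.pi / ρ * s - Real.arctan a) / Real.pi)
  rw [← hn] at h1 h2
  rw [div_le_iff₀ hπ] at h1
  rw [← sub_lt_iff_lt_add, lt_div_iff₀ hπ] at h2
  have e : Real.pi / ρ * (s + (ρ / Real.pi * (Real.arctan a + n * Real.pi) - s)) =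
      Real.arctan a + n * Real.pi := by field_simp; ring
  have e1 : s = ρ / Real.pi * (Real.pi / ρ * s) := by field_simp
  have hρπ : 0 < ρ / Real.pi := by positivity
  refine ⟨ρ / Real.pi * (Real.arctan a + n * Real.pi) - s, ?_, ?_, ?_, ?_⟩
  · have : ρ / Real.pi * (Real.pi / ρ * s) ≤ ρ / Real.pi * (Real.arctan a + n * Real.pi) :=
      mul_le_mul_of_nonneg_left (by linarith) hρπ.le
    linarith
  · have : ρ / Real.pi * (Real.arctan a + n * Real.pi) <
        ρ / Real.pi * (Real.pi / ρ * s + Real.pi) :=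
      mul_lt_mul_of_pos_left (by linarith) hρπ
    have e2 : ρ / Real.pi * Real.pi = ρ := by field_simp
    rw [mul_add (ρ / Real.pi) (Real.pi / ρ * s), ← e1, e2] at this
    linarith
  · rw [e, Real.tan_add_int_mul_pi, Real.tan_arctan]
  · rw [e, Real.cos_add_int_mul_pi]
    exact mul_ne_zero (zpow_ne_zero _ (by norm_num)) (Real.cos_arctan_pos a).ne'

theorem volume_inter_aboveTan_lt {ρ r : ℝ} {p x v : (Fin k → ℝ) × ℝ × ℝ}
    {ℓ : (Fin k → ℝ) × ℝ × ℝ →L[ℝ] ℝ} (hE : IsCompact E) (hρ : 0 < ρ)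
    (hp : Metric.ball p ρ ⊆ E) (hr : 1 ≤ r) (hℓ : ℓ (0, 1, 0) = 0) (hv : v.2.1 = 0)
    (hℓv : 0 < ℓ v) :
    volume (((fun w => r • w + x) '' E) ∩ aboveTan (Real.pi / ρ) ℓ) <
      volume (((fun w => r • w + (x + v)) '' E) ∩ aboveTan (Real.pi / ρ) ℓ) := by
  rw [volume_image_smul_add_inter]
  set A := (fun w => r • w + x) '' E with hA
  set T := aboveTan (Real.pi / ρ) ℓ with hT
  have hr0 : 0 < r := by linarith
  have hAc : IsCompact A := hE.image (by fun_prop)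
  have hT' : {w | w + v ∈ T} = {w | Real.tan (Real.pi / ρ * w.2.1) < ℓ w + ℓ v} := by
    ext w
    simp [hT, aboveTan, hv]
  have hsub : T ⊆ {w | w + v ∈ T} := by
    rw [hT']
    intro w hw
    exact lt_add_of_lt_of_nonneg hw hℓv.le
  set q := r • p + x with hq
  -- Moving along the `s`-axis leaves `ℓ` unchanged. At height `ℓ q + ℓ v / 2`, midway between the
  -- two thresholds, a whole neighbourhood is gained by the shift. Since `δ < ρ` and `1 ≤ r`, the
  -- point stays inside the copy of the ball.
  obtain ⟨δ, hδ0, hδρ, htan, hcos⟩ := exists_tan_eq hρ q.2.1 (ℓ q + ℓ v / 2)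
  set w₀ : (Fin k → ℝ) × ℝ × ℝ := q + δ • (0, 1, 0) with hw₀
  have hw₀s : w₀.2.1 = q.2.1 + δ := by simp [hw₀]
  have hw₀ℓ : ℓ w₀ = ℓ q := by
    rw [hw₀, map_add, map_smul, hℓ, smul_zero, add_zero]
  have hpos : 0 < volume ((A ∩ {w | w + v ∈ T}) \ T) := by
    refine MeasureTheory.Measure.measure_pos_of_mem_nhds volume (x := w₀) ?_
    have hAn : A ∈ nhds w₀ := by
      have hcont : ContinuousAt (fun w => r⁻¹ • (w - x)) w₀ := by fun_prop
      have h1 : r⁻¹ • (w₀ - x) ∈ Metric.ball p ρ := by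
        have : r⁻¹ • (w₀ - x) - p = (r⁻¹ * δ) • (0, 1, 0) := by
          rw [hw₀, hq, mul_smul, ← smul_right_injective _ hr0.ne' |>.eq_iff]
          simp only [smul_sub, smul_add, smul_inv_smul₀ hr0.ne']
          abel
        rw [mem_ball_iff_norm, this, norm_smul]
        have h2 : ‖((0, 1, 0) : (Fin k → ℝ) × ℝ × ℝ)‖ = 1 := by simp [Prod.norm_def]
        rw [h2, mul_one, Real.norm_eq_abs, abs_of_nonneg (by positivity)]
        have h3 : r⁻¹ ≤ 1 := inv_le_one_of_one_le₀ hr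
        nlinarith
      filter_upwards [hcont.eventually (Metric.isOpen_ball.mem_nhds h1)] with w hw
      exact ⟨_, hp hw, by simp only [smul_inv_smul₀ hr0.ne', sub_add_cancel]⟩
    have htc : ContinuousAt (fun w : (Fin k → ℝ) × ℝ × ℝ => Real.tan (Real.pi / ρ * w.2.1)) w₀ := by
      refine ContinuousAt.comp (g := Real.tan) (f := fun w : (Fin k → ℝ) × ℝ × ℝ =>
        Real.pi / ρ * w.2.1) ?_ (by fun_prop)
      rw [Real.continuousAt_tan]
      simpa only [hw₀s] using hcos
    have hval : Real.tan (Real.pi / ρ * w₀.2.1) = ℓ w₀ + ℓ v / 2 := by rw [hw₀s, hw₀ℓ, htan]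
    have hlc : ContinuousAt ℓ w₀ := ℓ.continuous.continuousAt
    have hlt1 : ∀ᶠ w in nhds w₀, ℓ w < Real.tan (Real.pi / ρ * w.2.1) :=
      hlc.eventually_lt htc (by rw [hval]; linarith)
    have hlt2 : ∀ᶠ w in nhds w₀, Real.tan (Real.pi / ρ * w.2.1) < ℓ w + ℓ v :=
      htc.eventually_lt (hlc.add continuousAt_const) (by rw [hval]; linarith)
    filter_upwards [hAn, hlt1, hlt2] with w h1 h2 h3
    refine ⟨⟨h1, ?_⟩, fun h => (lt_asymm h2 h)⟩
    rw [hT']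
    exact h3
  rw [← measure_inter_add_sdiff (A ∩ {w | w + v ∈ T}) (measurableSet_aboveTan _ ℓ), Set.inter_assoc,
    Set.inter_eq_right.2 hsub]
  refine ENNReal.lt_add_right ?_ hpos.ne'
  exact ((measure_mono Set.inter_subset_left).trans_lt hAc.measure_lt_top).ne

theorem exists_test_sets_of_round {ι : Type*} [Fintype ι] {K : ι → Set ((Fin k → ℝ) × ℝ × ℝ)}
    {c : ℝ} (hK : ∀ i, Convex ℝ (K i)) (hKc : ∀ i, IsCompact (K i))
    (hr : ∀ i, RoundAlong ((0, 0, 1) : (Fin k → ℝ) × ℝ × ℝ) (0, 1, 0) c (K i)) (hc : 0 < c)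
    (hint : (interior (⋃ i, K i)).Nonempty) :
    ∃ T : Fin (k + 3) → Set ((Fin k → ℝ) × ℝ × ℝ), (∀ i, MeasurableSet (T i)) ∧
      ∀ (r r' : ℝ) (x x' : (Fin k → ℝ) × ℝ × ℝ), 1 ≤ r → 1 ≤ r' →
        (∀ i, volume (((fun w => r • w + x) '' ⋃ i, K i) ∩ T i) =
          volume (((fun w => r' • w + x') '' ⋃ i, K i) ∩ T i)) → x = x' ∧ r = r' := by
  have hE : IsCompact (⋃ i, K i) := isCompact_iUnion hKc
  obtain ⟨p, hp⟩ := hint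
  obtain ⟨ρ, hρ, hball⟩ := Metric.isOpen_iff.1 isOpen_interior p hp
  replace hball := hball.trans interior_subset
  have hvol : 0 < volume.real (⋃ i, K i) :=
    ENNReal.toReal_pos (MeasureTheory.Measure.measure_pos_of_mem_nhds volume (mem_interior_iff_mem_nhds.1 hp)).ne'
      hE.measure_lt_top.ne
  obtain ⟨S, hSm, hS⟩ := exists_slab_set_strict_increase hK hKc hr hc hvol
  set E := ⋃ i, K i with hEdef
  have hfin : ∀ (r : ℝ) (x : (Fin k → ℝ) × ℝ × ℝ) (T : Set _),
      volume (((fun w => r • w + x) '' E) ∩ T) ≠ ⊤ := fun r x T =>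
    ((measure_mono Set.inter_subset_left).trans_lt
      (hE.image (f := fun w => r • w + x) (by fun_prop)).measure_lt_top).ne
  set slab : Set ((Fin k → ℝ) × ℝ × ℝ) := {v | v.2.1 ∈ S} with hslab
  set ℓy : (Fin k → ℝ) × ℝ × ℝ →L[ℝ] ℝ :=
    (ContinuousLinearMap.snd ℝ ℝ ℝ).comp (ContinuousLinearMap.snd ℝ (Fin k → ℝ) (ℝ × ℝ))
  set ℓz : Fin k → (Fin k → ℝ) × ℝ × ℝ →L[ℝ] ℝ := fun j =>
    (ContinuousLinearMap.proj j).comp (ContinuousLinearMap.fst ℝ (Fin k → ℝ) (ℝ × ℝ))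
  refine ⟨Fin.cons Set.univ (Fin.cons slab (Fin.cons (aboveTan (Real.pi / ρ) ℓy)
    fun j => aboveTan (Real.pi / ρ) (ℓz j))), ?_, ?_⟩
  · simp only [Fin.forall_fin_succ (n := k + 2), Fin.forall_fin_succ (n := k + 1),
      Fin.forall_fin_succ (n := k), Fin.cons_zero, Fin.cons_succ]
    exact ⟨MeasurableSet.univ, hSm.preimage measurable_snd.fst, measurableSet_aboveTan _ _,
      fun j => measurableSet_aboveTan _ _⟩
  · intro r r' x x' hr1 hr1' h
    simp only [Fin.forall_fin_succ (n := k + 2), Fin.forall_fin_succ (n := k + 1),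
      Fin.forall_fin_succ (n := k), Fin.cons_zero, Fin.cons_succ, Set.inter_univ] at h
    obtain ⟨h0, hs, hy, hz⟩ := h
    have hrr : r = r' := by
      have h1 : volume.real ((fun w => r • w + x) '' E) =
          volume.real ((fun w => r' • w + x') '' E) := by rw [measureReal_def, h0, measureReal_def]
      rw [volume_real_image_smul_add _ (by linarith), volume_real_image_smul_add _ (by linarith)]
        at h1
      exact (pow_left_inj₀ (by linarith) (by linarith) (by omega)).1 (mul_right_cancel₀ hvol.ne' h1)
    subst hrr
    refine ⟨?_, rfl⟩
    -- Slabs are invariant under translations that fix `s`, so the measure depends on `x` only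
    -- through its `s`-coordinate.
    set f : ℝ → ℝ := fun t => volume.real (((fun w => r • w + (0, t, 0)) '' E) ∩ slab) with hf
    have hfx : ∀ x : (Fin k → ℝ) × ℝ × ℝ,
        volume.real (((fun w => r • w + x) '' E) ∩ slab) = f x.2.1 := by
      intro x
      have e : x = (0, x.2.1, 0) + (x.1, 0, x.2.2) := by ext <;> simp
      conv_lhs => rw [e]
      rw [measureReal_def, volume_image_smul_add_inter, hf]
      simp [hslab, measureReal_def]
    have hmono : StrictMono f := by
      refine strictMono_of_forall_lt_add fun t τ hτ hτ1 => ?_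
      have h1 := hS r (0, t, 0) τ hr1 hτ hτ1
      have e : ((0, t + τ, 0) : (Fin k → ℝ) × ℝ × ℝ) = (0, t, 0) + (0, τ, 0) := by ext <;> simp
      have h2 : f (t + τ) =
          volume.real (((fun w => r • w + (0, t, 0)) '' E) ∩ {v | v.2.1 + τ ∈ S}) := by
        simp only [hf]
        rw [e, measureReal_def, volume_image_smul_add_inter]
        simp [hslab, measureReal_def]
      rw [h2]
      exact h1
    have hsx : x.2.1 = x'.2.1 := by
      refine hmono.injective ?_
      rw [← hfx, ← hfx, measureReal_def, hs, measureReal_def]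
    have hℓ : ∀ ℓ : (Fin k → ℝ) × ℝ × ℝ →L[ℝ] ℝ, ℓ (0, 1, 0) = 0 →
        volume (((fun w => r • w + x) '' E) ∩ aboveTan (Real.pi / ρ) ℓ) =
          volume (((fun w => r • w + x') '' E) ∩ aboveTan (Real.pi / ρ) ℓ) → ℓ x = ℓ x' := by
      intro ℓ hℓ0 heq
      rcases lt_trichotomy (ℓ x) (ℓ x') with h1 | h1 | h1
      · have := volume_inter_aboveTan_lt (x := x) (v := x' - x) hE hρ hball hr1 hℓ0
          (by simp [hsx]) (by rw [map_sub]; linarith)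
        rw [add_sub_cancel, heq] at this
        exact absurd this (lt_irrefl _)
      · exact h1
      · have := volume_inter_aboveTan_lt (x := x') (v := x - x') hE hρ hball hr1 hℓ0
          (by simp [hsx]) (by rw [map_sub]; linarith)
        rw [add_sub_cancel, heq] at this
        exact absurd this (lt_irrefl _)
    have hyx : x.2.2 = x'.2.2 := hℓ ℓy (by simp [ℓy]) hy
    have hzx : x.1 = x'.1 := funext fun j => hℓ (ℓz j) (by simp [ℓz]) (hz j)
    ext1
    · exact hzx
    · ext1
      · exact hsx
      · exact hyx

end

/-! ### Transfer to Euclidean space by a linear change of coordinates -/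

theorem RoundAlong.image_linearEquiv {V W : Type*} [AddCommGroup V] [Module ℝ V]
    [AddCommGroup W] [Module ℝ W] {u e : V} {c : ℝ} {K : Set V} (h : RoundAlong u e c K)
    (L : V ≃ₗ[ℝ] W) : RoundAlong (L u) (L e) c (L '' K) := by
  rintro _ ⟨a, ha, rfl⟩ ℓ hℓ ⟨b, hb, hab⟩
  have hb' : b = a + ℓ • u := L.injective (by rw [hab, map_add, map_smul])
  obtain ⟨h1, h2⟩ := h a ha ℓ hℓ (hb' ▸ hb)
  exact ⟨⟨_, h1, by simp⟩, ⟨_, h2, by simp⟩⟩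

theorem exists_test_sets_euclidean {k : ℕ} {ι : Type*} [Fintype ι]
    {K : ι → Set (EuclideanSpace ℝ (Fin (k + 2)))} {u : EuclideanSpace ℝ (Fin (k + 2))}
    (hK : ∀ i, Convex ℝ (K i)) (hKc : ∀ i, IsCompact (K i)) (hu : u ≠ 0)
    (hr : ∀ e, ∃ c, 0 < c ∧ ∀ i, RoundAlong u e c (K i))
    (hint : (interior (⋃ i, K i)).Nonempty) :
    ∃ T : Fin (k + 2 + 1) → Set (EuclideanSpace ℝ (Fin (k + 2))), (∀ i, MeasurableSet (T i)) ∧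
      ∀ (r r' : ℝ) (x x' : EuclideanSpace ℝ (Fin (k + 2))), 1 ≤ r → 1 ≤ r' →
        (∀ i, volume (((fun w => r • w + x) '' ⋃ i, K i) ∩ T i) =
          volume (((fun w => r' • w + x') '' ⋃ i, K i) ∩ T i)) → x = x' ∧ r = r' := by
  obtain ⟨L, hL⟩ : ∃ L : EuclideanSpace ℝ (Fin (k + 2)) ≃L[ℝ] (Fin k → ℝ) × ℝ × ℝ,
      L u = (0, 0, 1) := by
    have L₀ : EuclideanSpace ℝ (Fin (k + 2)) ≃L[ℝ] (Fin k → ℝ) × ℝ × ℝ :=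
      ContinuousLinearEquiv.ofFinrankEq (by simp)
    obtain ⟨A, hA⟩ := SeparatingDual.exists_continuousLinearEquiv_apply_eq (R := ℝ)
      (x := L₀ u) (y := ((0, 0, 1) : (Fin k → ℝ) × ℝ × ℝ)) (by simpa using hu) (by simp)
    exact ⟨L₀.trans A, by simpa using hA⟩
  -- `L` is prescribed only at `u`, so the preimage of the `s`-axis is uncontrolled; roundness is
  -- therefore assumed for every `e`.
  obtain ⟨c, hc, hround⟩ := hr (L.symm (0, 1, 0))
  have hU : L '' (⋃ i, K i) = ⋃ i, L '' K i := Set.image_iUnion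
  obtain ⟨T, hT, hTE⟩ := exists_test_sets_of_round (K := fun i => L '' K i) (c := c)
    (fun i => (hK i).linear_image L.toLinearMap) (fun i => (hKc i).image L.continuous)
    (fun i => by
      have := (hround i).image_linearEquiv L.toLinearEquiv
      simpa [hL] using this) hc
    (by
      rw [← hU]
      have := L.toHomeomorph.image_interior (⋃ i, K i)
      exact this ▸ hint.image _)
  refine ⟨fun i => L ⁻¹' T i, fun i => (hT i).preimage L.continuous.measurable,
    fun r r' x x' hr1 hr1' h => ?_⟩
  -- `L` preserves volume up to a constant factor, which does not affect equality of measures.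
  have hvol : ∀ B : Set ((Fin k → ℝ) × ℝ × ℝ), volume B =
      Measure.addHaarScalarFactor volume (Measure.map L volume) • volume (L ⁻¹' B) := by
    intro B
    have := Measure.isAddLeftInvariant_eq_smul (volume : Measure ((Fin k → ℝ) × ℝ × ℝ))
      (Measure.map L volume)
    conv_lhs => rw [this]
    rw [Measure.smul_apply]
    exact congrArg _ (L.toHomeomorph.toMeasurableEquiv.map_apply (μ := volume) B)
  have himg : ∀ (r : ℝ) (x : EuclideanSpace ℝ (Fin (k + 2))) (i : Fin (k + 3)),
      L ⁻¹' (((fun w => r • w + L x) '' ⋃ i, L '' K i) ∩ T i) =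
        ((fun w => r • w + x) '' ⋃ i, K i) ∩ L ⁻¹' T i := by
    intro r x i
    have : (fun w => r • w + L x) '' (⋃ i, L '' K i) = L '' ((fun w => r • w + x) '' ⋃ i, K i) := by
      rw [← hU, Set.image_image, Set.image_image]
      simp
    rw [Set.preimage_inter, this, Set.preimage_image_eq _ L.injective]
  obtain ⟨h1, h2⟩ := hTE r r' (L x) (L x') hr1 hr1' fun i => by
    rw [hvol, hvol, himg, himg, h i]
  exact ⟨L.injective h1, h2⟩

/-! ### Roundness of balls and of simplices -/

section Geometry

variable {X : Type*} [NormedAddCommGroup X]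

/-- By the parallelogram law the midpoint has squared norm at most `1 - ℓ² / 4`, hence norm at most
`1 - ℓ² / 8`. -/
theorem roundAlong_closedBall [InnerProductSpace ℝ X] {u : X} (hu : ‖u‖ = 1) (e : X) :
    RoundAlong u e (1 / (8 * (‖e‖ + 1))) (Metric.closedBall (0 : X) 1) := by
  intro a ha ℓ hℓ hb
  rw [mem_closedBall_zero_iff] at ha hb
  have hpar := parallelogram_law_with_norm ℝ (a + (ℓ / 2) • u) ((ℓ / 2) • u)
  have e1 : a + (ℓ / 2) • u + (ℓ / 2) • u = a + ℓ • u := by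
    rw [add_assoc, ← add_smul, add_halves]
  rw [e1, add_sub_cancel_right, norm_smul, hu, mul_one, Real.norm_eq_abs,
    abs_of_nonneg (show 0 ≤ ℓ / 2 by positivity)] at hpar
  have hm : ‖a + (ℓ / 2) • u‖ ≤ 1 - ℓ ^ 2 / 8 := by
    have h0 := norm_nonneg (a + (ℓ / 2) • u)
    have h1 := norm_nonneg a
    have h2 := norm_nonneg (a + ℓ • u)
    have h3 : ‖a + (ℓ / 2) • u‖ ^ 2 ≤ 1 - ℓ ^ 2 / 4 := by nlinarith
    nlinarith [sq_nonneg (‖a + (ℓ / 2) • u‖ - 1)]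
  have he : ‖(1 / (8 * (‖e‖ + 1)) * ℓ ^ 2) • e‖ ≤ ℓ ^ 2 / 8 := by
    have h0 := norm_nonneg e
    rw [norm_smul, Real.norm_eq_abs, abs_of_nonneg (by positivity)]
    have : 1 / (8 * (‖e‖ + 1)) * ℓ ^ 2 * ‖e‖ = ℓ ^ 2 / 8 * (‖e‖ / (‖e‖ + 1)) := by field_simp
    rw [this]
    exact mul_le_of_le_one_right (by positivity) ((div_le_one (by positivity)).2 (by linarith))
  rw [mem_closedBall_zero_iff, mem_closedBall_zero_iff]
  exact ⟨(norm_add_le _ _).trans (by linarith), (norm_sub_le _ _).trans (by linarith)⟩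

variable [NormedSpace ℝ X]

/-- At the midpoint each `f i` is at least `ℓ |f i u| / 2` (linear parts), which is linear in `ℓ`.
The displacement changes it by `c ℓ² |f i e|`, smaller for small `c` because chords have bounded
length. Stating this for all small `c` lets finitely many bodies share one constant. -/
theorem eventually_roundAlong_of_halfspaces {κ : Type*} [Finite κ] {f : κ → X →ᵃ[ℝ] ℝ} {u e : X}
    (hb : Bornology.IsBounded {x | ∀ i, 0 ≤ f i x}) (hu : u ≠ 0)
    (hf : ∀ i, (f i).linear u = 0 → (f i).linear e = 0) :
    ∀ᶠ c in nhdsWithin (0 : ℝ) (Set.Ioi 0), RoundAlong u e c {x | ∀ i, 0 ≤ f i x} := by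
  obtain ⟨R, hR⟩ := hb.exists_norm_le
  set D : ℝ := 2 * R / ‖u‖
  have hD : ∀ a ∈ {x | ∀ i, 0 ≤ f i x}, ∀ ℓ : ℝ, 0 ≤ ℓ → a + ℓ • u ∈ {x | ∀ i, 0 ≤ f i x} →
      ℓ ≤ D := by
    intro a ha ℓ hℓ hb
    rw [le_div_iff₀ (norm_pos_iff.2 hu)]
    have h1 : ‖ℓ • u‖ ≤ ‖a + ℓ • u‖ + ‖a‖ := by
      have := norm_sub_le (a + ℓ • u) a
      rwa [add_sub_cancel_left] at this
    rw [norm_smul, Real.norm_eq_abs, abs_of_nonneg hℓ] at h1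
    linarith [hR _ ha, hR _ hb]
  have hsmall : ∀ᶠ c in nhdsWithin (0 : ℝ) (Set.Ioi 0),
      ∀ i, c * D * |(f i).linear e| ≤ |(f i).linear u| / 2 := by
    rw [Filter.eventually_all]
    intro i
    by_cases h0 : (f i).linear u = 0
    · simp [h0, hf i h0]
    · have : Filter.Tendsto (fun c : ℝ => c * D * |(f i).linear e|) (nhds 0) (nhds 0) := by
        have : Continuous fun c : ℝ => c * D * |(f i).linear e| := by fun_prop
        simpa using this.tendsto 0
      refine nhdsWithin_le_nhds ((this.eventually_lt_const ?_).mono fun c hc => hc.le)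
      have := abs_pos.2 h0
      positivity
  filter_upwards [hsmall, self_mem_nhdsWithin] with c hc hc0 a ha ℓ hℓ hb
  have hc0' : 0 < c := hc0
  have hval : ∀ (i : κ) (x w : X), f i (x + w) = f i x + (f i).linear w := by
    intro i x w
    have := (f i).map_vadd x w
    rw [vadd_eq_add, vadd_eq_add] at this
    rw [add_comm x w, this, add_comm]
  have key : ∀ i, |c * ℓ ^ 2 * (f i).linear e| ≤ f i a + ℓ / 2 * (f i).linear u := by
    intro i
    have h1 := ha i
    have h2 := hb i
    rw [hval, map_smul, smul_eq_mul] at h2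
    have h3 : ℓ * |(f i).linear u| / 2 ≤ f i a + ℓ / 2 * (f i).linear u := by
      rcases abs_cases ((f i).linear u) with h | h <;> rw [h.1] <;> linarith
    refine le_trans ?_ h3
    rw [abs_mul, abs_of_nonneg (by positivity)]
    calc c * ℓ ^ 2 * |(f i).linear e| = ℓ * (c * ℓ * |(f i).linear e|) := by ring
      _ ≤ ℓ * (c * D * |(f i).linear e|) := by
          have := hD a ha ℓ hℓ hb
          gcongr
      _ ≤ ℓ * (|(f i).linear u| / 2) := mul_le_mul_of_nonneg_left (hc i) hℓ
      _ = ℓ * |(f i).linear u| / 2 := by ring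
  constructor
  · intro i
    have := (abs_le.1 (key i)).1
    rw [hval, hval, map_smul, map_smul, smul_eq_mul, smul_eq_mul]
    linarith
  · intro i
    have := (abs_le.1 (key i)).2
    rw [sub_eq_add_neg, hval, hval, map_neg, map_smul, map_smul, smul_eq_mul, smul_eq_mul]
    linarith

theorem exists_subspaces_eventually_roundAlong_simplex (t : Finset X)
    (ht : AffineIndependent ℝ ((↑) : t → X)) :
    ∃ 𝒲 : Set (Submodule ℝ X), 𝒲.Finite ∧ ⊤ ∉ 𝒲 ∧ ∀ u, u ≠ 0 → (∀ p ∈ 𝒲, u ∉ p) → ∀ e,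
      ∀ᶠ c in nhdsWithin (0 : ℝ) (Set.Ioi 0), RoundAlong u e c (convexHull ℝ (t : Set X)) := by
  rcases t.eq_empty_or_nonempty with rfl | hne
  · exact ⟨∅, Set.finite_empty, id, fun u _ _ e => Filter.Eventually.of_forall fun c a ha => by
      simp at ha⟩
  by_cases htop : affineSpan ℝ (t : Set X) = ⊤
  · have hrange : Set.range ((↑) : t → X) = t := Subtype.range_coe
    let b : AffineBasis t ℝ X := ⟨((↑) : t → X), ht, by rw [hrange]; exact htop⟩
    have hhull : convexHull ℝ (t : Set X) = {x | ∀ i, 0 ≤ b.coord i x} := by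
      rw [← b.convexHull_eq_nonneg_coord]
      exact congrArg _ hrange.symm
    -- The directions to avoid are those parallel to a facet. A constant coordinate has kernel `⊤`,
    -- constrains nothing, and is dropped.
    refine ⟨(Set.range fun i => LinearMap.ker (b.coord i).linear) \ {⊤},
      (Set.finite_range _).subset Set.sdiff_subset, fun h => h.2 rfl, fun u hu hup e => ?_⟩
    rw [hhull]
    refine eventually_roundAlong_of_halfspaces ?_ hu fun i hi => ?_
    · rw [← hhull]
      exact isBounded_convexHull.2 t.finite_toSet.isBounded
    · by_cases hk : LinearMap.ker (b.coord i).linear = ⊤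
      · rw [LinearMap.ker_eq_top.1 hk, LinearMap.zero_apply]
      · exact absurd (LinearMap.mem_ker.2 hi) (hup _ ⟨⟨i, rfl⟩, hk⟩)
  -- A degenerate simplex has no chord of positive length in a direction outside its affine span.
  · refine ⟨{(affineSpan ℝ (t : Set X)).direction}, Set.finite_singleton _, fun h => htop ?_,
      fun u _ hup e => Filter.Eventually.of_forall fun c a ha ℓ hℓ hb => ?_⟩
    · have hne' : (affineSpan ℝ (t : Set X) : Set X).Nonempty :=
        (affineSpan_nonempty ℝ).2 hne
      exact (AffineSubspace.direction_eq_top_iff_of_nonempty hne').1 h.symm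
    · have hsub := convexHull_subset_affineSpan (𝕜 := ℝ) (t : Set X)
      have h1 := AffineSubspace.vsub_mem_direction (hsub hb) (hsub ha)
      rw [vsub_eq_sub, add_sub_cancel_left] at h1
      have hℓ0 : ℓ = 0 := by
        by_contra h
        exact hup _ rfl ((Submodule.smul_mem_iff _ h).1 h1)
      subst hℓ0
      simpa using ha

/-- A finite union of convex hulls of finite sets is a finite union of simplices, all of which are
round along a common generic direction. -/
theorem exists_round_simplices_of_union_convexHull {E : Set X} {F : Set (Set X)} (hF : F.Finite)
    (hFs : ∀ P ∈ F, ∃ s : Set X, s.Finite ∧ P = convexHull ℝ s) (hE : E = ⋃₀ F) [Nontrivial X] :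
    ∃ (I : Finset (Finset X)) (u : X), u ≠ 0 ∧ E = ⋃ t : I, convexHull ℝ (t : Set X) ∧
      ∀ e, ∃ c, 0 < c ∧ ∀ t : I, RoundAlong u e c (convexHull ℝ (t : Set X)) := by
  classical
  choose! s hsf hs using hFs
  have hUf : (⋃ P ∈ F, s P).Finite := hF.biUnion hsf
  set I : Finset (Finset X) := hUf.toFinset.powerset.filter fun t =>
    AffineIndependent ℝ ((↑) : t → X) ∧ convexHull ℝ (t : Set X) ⊆ E with hI
  have hIai : ∀ t : I, AffineIndependent ℝ (Subtype.val : {x // x ∈ t.1} → X) := fun t =>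
    (Finset.mem_filter.1 t.2).2.1
  have hEI : E = ⋃ t : I, convexHull ℝ ((t : Finset X) : Set X) := by
    refine Set.Subset.antisymm ?_ (Set.iUnion_subset fun t => (Finset.mem_filter.1 t.2).2.2)
    intro x hx
    rw [hE] at hx
    obtain ⟨P, hP, hxP⟩ := hx
    have hPE : P ⊆ E := hE ▸ Set.subset_sUnion_of_mem hP
    have hxP' := hxP
    -- Carathéodory: each point lies in a simplex spanned by some of the given vertices.
    rw [hs P hP, convexHull_eq_union] at hxP'
    simp only [Set.mem_iUnion] at hxP'
    obtain ⟨t, hts, hai, hxt⟩ := hxP'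
    refine Set.mem_iUnion.2 ⟨⟨t, Finset.mem_filter.2 ⟨?_, hai, ?_⟩⟩, hxt⟩
    · rw [Finset.mem_powerset]
      intro y hy
      exact hUf.mem_toFinset.2 (Set.mem_biUnion hP (hts hy))
    · exact (convexHull_mono hts).trans ((hs P hP) ▸ hPE)
  choose 𝒲 hWf hWtop hW using fun t : I => exists_subspaces_eventually_roundAlong_simplex _ (hIai t)
  -- A real vector space is not a finite union of proper subspaces; including `⊥` forces `u ≠ 0`.
  have hfin : (insert ⊥ (⋃ t, 𝒲 t)).Finite := (Set.finite_iUnion hWf).insert ⊥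
  have hne : (⋃ p ∈ hfin.toFinset, (p : Set X)) ≠ Set.univ := by
    refine Subspace.biUnion_ne_univ_of_top_notMem ?_
    simp only [Set.Finite.mem_toFinset, Set.mem_insert_iff, Set.mem_iUnion, not_or, not_exists]
    exact ⟨top_ne_bot, hWtop⟩
  obtain ⟨u, hu⟩ := (Set.ne_univ_iff_exists_notMem _).1 hne
  simp only [Set.mem_iUnion, Set.Finite.mem_toFinset, Set.mem_insert_iff, SetLike.mem_coe,
    not_exists] at hu
  have hu0 : u ≠ 0 := fun h => hu ⊥ (Or.inl rfl) (by simp [h])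
  refine ⟨I, u, hu0, hEI, fun e => ?_⟩
  have hev : ∀ᶠ c in nhdsWithin (0 : ℝ) (Set.Ioi 0),
      ∀ t : I, RoundAlong u e c (convexHull ℝ ((t : Finset X) : Set X)) := by
    rw [Filter.eventually_all]
    exact fun t => hW t u hu0 (fun p hp => hu p (Or.inr ⟨t, hp⟩)) e
  obtain ⟨c, h1, h2⟩ := (hev.and self_mem_nhdsWithin).exists
  exact ⟨c, h2, h1⟩

end Geometry

/-! ### Conclusion for balls and polytopes -/

theorem canBeReconstructed_magnifiedCopies {d n : ℕ} {E : Set (EuclideanSpace ℝ (Fin d))}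
    (hE : IsCompact E)
    (h : ∃ T : Fin n → Set (EuclideanSpace ℝ (Fin d)), (∀ i, MeasurableSet (T i)) ∧
      ∀ (r r' : ℝ) (x x' : EuclideanSpace ℝ (Fin d)), 1 ≤ r → 1 ≤ r' →
        (∀ i, volume (((fun w => r • w + x) '' E) ∩ T i) =
          volume (((fun w => r' • w + x') '' E) ∩ T i)) → x = x' ∧ r = r') :
    CanBeReconstructed (magnifiedCopies E) n := by
  refine ⟨?_, ?_⟩
  · rintro _ ⟨x, r, -, rfl⟩
    have : IsCompact ((fun y => r • y + x) '' E) := hE.image (by fun_prop)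
    exact ⟨this.measurableSet.nullMeasurableSet, this.measure_lt_top⟩
  · obtain ⟨T, hT, hTE⟩ := h
    refine ⟨T, fun i => (hT i).nullMeasurableSet, ?_⟩
    rintro _ ⟨x, r, hr, rfl⟩ _ ⟨x', r', hr', rfl⟩ heq
    obtain ⟨rfl, rfl⟩ := hTE r r' x x' hr hr' heq
    rfl

theorem image_smul_add_closedBall {X : Type*} [NormedAddCommGroup X] [NormedSpace ℝ X] {r : ℝ}
    (hr : 0 < r) (x : X) :
    (fun y => r • y + x) '' Metric.closedBall (0 : X) 1 = Metric.closedBall x r := by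
  ext y
  simp only [Set.mem_image, mem_closedBall_iff_norm, sub_zero]
  constructor
  · rintro ⟨v, hv, rfl⟩
    rw [add_sub_cancel_right, norm_smul, Real.norm_eq_abs, abs_of_pos hr]
    nlinarith
  · intro hy
    refine ⟨r⁻¹ • (y - x), ?_, by rw [smul_inv_smul₀ hr.ne', sub_add_cancel]⟩
    rw [norm_smul, norm_inv, Real.norm_eq_abs, abs_of_pos hr, inv_mul_le_iff₀ hr, mul_one]
    exact hy

theorem largeBalls_eq_magnifiedCopies (d : ℕ) :
    largeBalls d = magnifiedCopies (Metric.closedBall (0 : EuclideanSpace ℝ (Fin d)) 1) := by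
  ext A
  constructor
  · rintro ⟨x, r, hr, rfl⟩
    exact ⟨x, r, hr, (image_smul_add_closedBall (by linarith) x).symm⟩
  · rintro ⟨x, r, hr, rfl⟩
    exact ⟨x, r, hr, image_smul_add_closedBall (by linarith) x⟩

theorem corollaryc (d : ℕ) (hd : 2 ≤ d) :
    (CanBeReconstructed (largeBalls d) (d + 1) ∧
      ∃ T : Fin (d + 1) → Set (EuclideanSpace ℝ (Fin d)),
        (∀ i, NullMeasurableSet (T i) volume) ∧
        ∀ (x x' : EuclideanSpace ℝ (Fin d)) (r r' : ℝ), 1 ≤ r → 1 ≤ r' → (x, r) ≠ (x', r') →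
          ∃ i, volume (Metric.closedBall x r ∩ T i) ≠ volume (Metric.closedBall x' r' ∩ T i)) ∧
    (∀ E : Set (EuclideanSpace ℝ (Fin d)), IsPolytope E →
      CanBeReconstructed (magnifiedCopies E) (d + 1)) := by
  obtain ⟨k, rfl⟩ := Nat.exists_eq_add_of_le' hd
  constructor
  · obtain ⟨u, hu⟩ := exists_norm_eq (EuclideanSpace ℝ (Fin (k + 2))) zero_le_one
    have hball := exists_test_sets_euclidean (k := k) (ι := Unit) (u := u)
      (K := fun _ => Metric.closedBall 0 1) (fun _ => convex_closedBall _ _)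
      (fun _ => isCompact_closedBall _ _) (by rintro rfl; simp at hu)
      (fun e => ⟨_, by positivity, fun _ => roundAlong_closedBall hu e⟩)
      (by
        rw [Set.iUnion_const]
        exact ⟨0, Metric.ball_subset_interior_closedBall (Metric.mem_ball_self one_pos)⟩)
    simp only [Set.iUnion_const] at hball
    refine ⟨?_, ?_⟩
    · rw [largeBalls_eq_magnifiedCopies]
      exact canBeReconstructed_magnifiedCopies (isCompact_closedBall _ _) hball
    · obtain ⟨T, hT, hTE⟩ := hball
      refine ⟨T, fun i => (hT i).nullMeasurableSet, fun x x' r r' hr hr' hne => ?_⟩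
      by_contra! hcon
      refine hne ?_
      obtain ⟨rfl, rfl⟩ := hTE r r' x x' hr hr' fun i => by
        rw [image_smul_add_closedBall (by linarith), image_smul_add_closedBall (by linarith), hcon i]
      rfl
  · rintro E ⟨hint, F, hF, hFs, hEF⟩
    obtain ⟨I, u, hu, hEI, hround⟩ := exists_round_simplices_of_union_convexHull hF hFs hEF
    have hcomp : ∀ t : I, IsCompact (convexHull ℝ (t.1 : Set (EuclideanSpace ℝ (Fin (k + 2))))) :=
      fun t => t.1.finite_toSet.isCompact_convexHull (𝕜 := ℝ)
    rw [hEI] at hint ⊢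
    exact canBeReconstructed_magnifiedCopies (isCompact_iUnion hcomp)
      (exists_test_sets_euclidean (fun t => convex_convexHull ℝ _) hcomp hu hround hint)
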